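/- Let $(M,\mu)$ be a planar map geometry: a finite connected map $M$ drawn on the Euclidean plane (vertices are distinct points, edges are arcs meeting only at their ends, loops and multiple edges allowed) in which every vertex $v$ has valency $\rho_M(v)\ge 3$, angle factors $0<\mu(v)<4\pi/\rho_M(v)$, and an angle function $f$ on the plane with $f(v)=\rho_M(v)\mu(v)/2$ at each vertex $v$, $f$ smooth and monotone along each edge, and $f=\pi$ off $M$. A point $x$ is elliptic, euclidean or hyperbolic according as $f(x)<\pi$, $f(x)=\pi$ or $f(x)>\pi$. A (directed) $m$-line segment is a path of finitely many straight line segments whose angle, measured on the left of the direction of travel, is $f(x)$ at each point $x$ of $M$ that it passes through, and which is straight at all other points. An $n$-polygon ($n\ge 1$) is a closed curve without self-intersections, traversed counterclockwise, made of $n$ $m$-line segments (its edges) joined one after another at its $n$ vertices; thus the angles of its edges are measured on the interior side. Its internal angles are the angles on the interior side at its $n$ vertices. Then the edges of an $n$-polygon (end points excluded) pass through only finitely many non-euclidean points, and if these are the distinct points $x_1,\dots,x_l$ ($l\ge 0$), the sum of the $n$ internal angles is $$(n+l-2)\pi-\sum_{i=1}^{l}f(x_i).$$ Consequently the sum of the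 internal angles of a triangle ($3$-polygon) is equal to $\pi$ if the triangle is euclidean (its edges pass through no non-euclidean point), greater than $\pi$ if it is elliptic (its edges pass through at least one non-euclidean point, and all of these are elliptic), and less than $\pi$ if it is hyperbolic (its edges pass through at least one non-euclidean point, and all of these are hyperbolic). -/

import Mathlib

open Real

/-- A (finite, connected) map drawn on the Euclidean plane `ℂ`: the vertices are distinct points,
each edge is a continuous arc joining two (possibly equal) vertices, and the arcs meet one another,
themselves and the vertices only at their ends. Loops and multiple edges are allowed. -/
structure PlanarMap (V E : Type*) [Finite V] [Finite E] where
  pos : V → ℂ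
  pos_injective : Function.Injective pos
  src : E → V
  tgt : E → V
  arc : E → ℝ → ℂ
  arc_continuousOn : ∀ e, ContinuousOn (arc e) (Set.Icc 0 1)
  arc_zero : ∀ e, arc e 0 = pos (src e)
  arc_one : ∀ e, arc e 1 = pos (tgt e)
  arc_injOn : ∀ e, Set.InjOn (arc e) (Set.Ioo 0 1)
  arc_ne_pos : ∀ e, ∀ t ∈ Set.Ioo (0 : ℝ) 1, ∀ v, arc e t ≠ pos v
  arc_ne_arc : ∀ e e', e ≠ e' → ∀ t ∈ Set.Ioo (0 : ℝ) 1, ∀ t' ∈ Set.Ioo (0 : ℝ) 1,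
    arc e t ≠ arc e' t'
  connected : IsConnected (Set.range pos ∪ ⋃ e, arc e '' Set.Icc 0 1)

namespace PlanarMap

variable {V E : Type*} [Finite V] [Finite E]

/-- The points of the plane that lie on the map (on a vertex or an edge). -/
def carrier (M : PlanarMap V E) : Set ℂ :=
  Set.range M.pos ∪ ⋃ e, M.arc e '' Set.Icc 0 1

/-- The valency `ρ_M(v)`: the number of edge ends at `v` (a loop counts twice). -/
noncomputable def valency (M : PlanarMap V E) (v : V) : ℕ :=
  Nat.card {e // M.src e = v} + Nat.card {e // M.tgt e = v}

end PlanarMap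

/-- A planar map geometry `(M, μ)` with its angle function `f`: every vertex has valency at
least `3`, the angle factors satisfy `0 < μ v < 4π / ρ(v)`, and `f` takes the value `ρ(v) μ(v) / 2`
at each vertex, is smooth and monotone along each edge, and is `π` away from the map. -/
structure PlanarMapGeometry (V E : Type*) [Finite V] [Finite E] extends PlanarMap V E where
  three_le_valency : ∀ v, 3 ≤ toPlanarMap.valency v
  mu : V → ℝ
  mu_pos : ∀ v, 0 < mu v
  mu_lt : ∀ v, mu v < 4 * π / toPlanarMap.valency v
  angle : ℂ → ℝ
  angle_pos : ∀ v, angle (pos v) = toPlanarMap.valency v * mu v / 2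
  angle_smooth : ∀ e, ContDiffOn ℝ (⊤ : ℕ∞) (fun t => angle (arc e t)) (Set.Icc 0 1)
  angle_monotone : ∀ e, MonotoneOn (fun t => angle (arc e t)) (Set.Icc 0 1) ∨
    AntitoneOn (fun t => angle (arc e t)) (Set.Icc 0 1)
  angle_off : ∀ x ∉ toPlanarMap.carrier, angle x = π

/-- The angle, in `[0, 2π)`, on the left-hand side of the path `A → B → C` at `B`, i.e. the angle
through which the ray `BA` has to be turned clockwise to reach the ray `BC`. -/
noncomputable def leftAngle (A B C : ℂ) : ℝ :=
  toIcoMod Real.two_pi_pos 0 (Complex.arg ((A - B) / (C - B)))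

/-- The straight piece from `A` to `B`, containing `A` but not `B`. -/
def halfOpenSegment (A B : ℂ) : Set ℂ :=
  (fun t : ℝ => A + t * (B - A)) '' Set.Ico 0 1

namespace PlanarMapGeometry

variable {V E : Type*} [Finite V] [Finite E]

def IsEuclideanPt (G : PlanarMapGeometry V E) (x : ℂ) : Prop := G.angle x = π

def IsEllipticPt (G : PlanarMapGeometry V E) (x : ℂ) : Prop := G.angle x < π

def IsHyperbolicPt (G : PlanarMapGeometry V E) (x : ℂ) : Prop := π < G.angle x

/-- A directed `m`-line segment: the polygonal path `node 0, node 1, …, node len` (the values of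
`node` beyond `len` play no role), which goes straight through euclidean points and has at each
intermediate node `x` an angle of measure `f(x)`. In particular it can pass through a non-euclidean
point only at an intermediate node. Angles are measured on the left of the direction of travel
(clockwise from the entering ray to the leaving ray). -/
structure MSegment (G : PlanarMapGeometry V E) where
  len : ℕ
  len_pos : 0 < len
  node : ℕ → ℂ
  node_ne : ∀ i < len, node i ≠ node (i + 1)
  straight : ∀ i < len, ∀ x ∈ openSegment ℝ (node i) (node (i + 1)), G.IsEuclideanPt x
  bend : ∀ i, i + 1 < len →
    leftAngle (node i) (node (i + 1)) (node (i + 2)) = G.angle (node (i + 1))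

/-- The points through which an `m`-line segment passes, its two end points excluded. -/
def MSegment.inner {G : PlanarMapGeometry V E} (s : G.MSegment) : Set ℂ :=
  {x | ∃ i < s.len, x ∈ openSegment ℝ (s.node i) (s.node (i + 1)) ∨ (0 < i ∧ x = s.node i)}

/-- An `n`-polygon: `n` directed `m`-line segments, each beginning where the previous one ends
(cyclically), that together form a closed curve without self-intersections. The curve is traversed
counterclockwise (its signed area is positive), so the interior is on the left, which is the
side on which the angles of the `m`-line segments are measured. -/
structure Polygon (G : PlanarMapGeometry V E) (n : ℕ) [NeZero n] where
  edge : Fin n → G.MSegment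
  joined : ∀ j, (edge j).node (edge j).len = (edge (j + 1)).node 0
  simple : ∀ j j' : Fin n, ∀ i < (edge j).len, ∀ i' < (edge j').len, (j ≠ j' ∨ i ≠ i') →
    Disjoint (halfOpenSegment ((edge j).node i) ((edge j).node (i + 1)))
      (halfOpenSegment ((edge j').node i') ((edge j').node (i' + 1)))
  counterclockwise : 0 < (1 / 2 : ℝ) * ∑ j, ∑ i ∈ Finset.range (edge j).len,
    (((edge j).node i).re * ((edge j).node (i + 1)).im -
      ((edge j).node (i + 1)).re * ((edge j).node i).im)

namespace Polygon

variable {G : PlanarMapGeometry V E} {n : ℕ} [NeZero n]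

/-- The internal angle at the vertex where edge `j` ends and edge `j + 1` begins: the angle
on the interior side, which is the left one. -/
noncomputable def internalAngle (P : G.Polygon n) (j : Fin n) : ℝ :=
  leftAngle ((P.edge j).node ((P.edge j).len - 1)) ((P.edge j).node (P.edge j).len)
    ((P.edge (j + 1)).node 1)

/-- The non-euclidean points through which the edges pass (vertices of the polygon excluded). -/
def nonEuclideanPts (P : G.Polygon n) : Set ℂ :=
  {x | (∃ j, x ∈ (P.edge j).inner) ∧ ¬ G.IsEuclideanPt x}

/-- The edges pass through euclidean points only. -/
def IsEuclidean (P : G.Polygon n) : Prop := P.nonEuclideanPts = ∅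

/-- The edges pass through non-euclidean points, and all of these are elliptic. -/
def IsElliptic (P : G.Polygon n) : Prop :=
  P.nonEuclideanPts.Nonempty ∧ ∀ x ∈ P.nonEuclideanPts, G.IsEllipticPt x

/-- The edges pass through non-euclidean points, and all of these are hyperbolic. -/
def IsHyperbolic (P : G.Polygon n) : Prop :=
  P.nonEuclideanPts.Nonempty ∧ ∀ x ∈ P.nonEuclideanPts, G.IsHyperbolicPt x

end Polygon

end PlanarMapGeometry

/-! Listing the nodes of all edges in cyclic order turns the polygon into an ordinary simple
Euclidean polygon with `N` vertices, whose left angles add up to `(N - 2)π`. Here `N` is `n` plus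
the number of intermediate nodes. At such a node the left angle is `f`, so it contributes `f - π`
beyond what it adds to `Nπ`. This vanishes at euclidean points, and what remains is the stated
formula.

The Euclidean angle sum is Hopf's theorem that the exterior angles add up to `2π`
(`sum_extAngle_of_signedArea_pos`). Hopf's homotopy is discretised: the secant directions `p j - p
i` are compared around each pair of edges, and disjoint edges are strictly separated by a line, so
no cell produces a jump (`secant_cell`). The turning is thereby reduced to secants through `p 0`. If
`p 0` is extreme these lie in a half-plane, and the total is `2π` or `-2π` according to the turn at
`p 0` (`sum_extAngle_of_extreme_zero`).

Orientation is given by signed area, so turning `2π` must be shown to force positive area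
(`signedArea_pos`). This goes by induction: at an extreme vertex either a triangle can be cut off or
a diagonal splits the polygon. Area is additive, and an extreme vertex with known turn shows that
each part again has turning `2π`. Reflection handles turning `-2π`. -/

/-! ### Arguments of vectors in a half-plane, and separation of segments -/

/-- The cross product of two plane vectors. -/
def planeCross (a b : ℂ) : ℝ := a.re * b.im - b.re * a.im

/-- Positivity for the lexicographic order on the plane. -/
def LexPos (z : ℂ) : Prop := 0 < z.re ∨ (z.re = 0 ∧ 0 < z.im)

lemma LexPos.ne_zero {z : ℂ} (h : LexPos z) : z ≠ 0 := by
  rintro rfl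
  simp [LexPos] at h

lemma LexPos.arg_mem {z : ℂ} (h : LexPos z) : Complex.arg z ∈ Set.Ioc (-(π / 2)) (π / 2) := by
  have hz := h.ne_zero
  refine ⟨?_, Complex.arg_le_pi_div_two_iff.2 ?_⟩
  · rw [Complex.neg_pi_div_two_lt_arg_iff]
    rcases h with h | h
    · exact Or.inl h
    · exact Or.inr h.2.le
  · rcases h with h | h
    · exact Or.inl h.le
    · exact Or.inl h.1.ge

/-- Both arguments lie in a half-open interval of length `π`, so their difference is within `(-π,
π)` and the identity modulo `2π` holds for real numbers. -/
lemma LexPos.arg_div {a b c : ℂ} (ha : LexPos (c * a)) (hb : LexPos (c * b)) :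
    Complex.arg (b / a) = Complex.arg (c * b) - Complex.arg (c * a) := by
  have hc : c ≠ 0 := left_ne_zero_of_mul ha.ne_zero
  have h1 := ha.arg_mem
  have h2 := hb.arg_mem
  have hmem : Complex.arg (c * b) - Complex.arg (c * a) ∈ Set.Ioc (-π) π :=
    ⟨by linarith [h1.1, h1.2, h2.1, h2.2], by linarith [h1.1, h1.2, h2.1, h2.2]⟩
  rw [← mul_div_mul_left b a hc, ← Complex.arg_coe_angle_toReal_eq_arg,
    Complex.arg_div_coe_angle hb.ne_zero ha.ne_zero, ← Real.Angle.coe_sub,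
    Real.Angle.toReal_coe_eq_self_iff.2 hmem]

/-- Angles between vectors of a common half-plane are additive. -/
lemma LexPos.arg_div_add {a b d c : ℂ} (ha : LexPos (c * a)) (hb : LexPos (c * b))
    (hd : LexPos (c * d)) :
    Complex.arg (b / a) + Complex.arg (d / b) = Complex.arg (d / a) := by
  rw [ha.arg_div hb, hb.arg_div hd, ha.arg_div hd]
  ring

lemma exists_re_mul_eq (f : ℂ →L[ℝ] ℝ) : ∃ c : ℂ, ∀ z, (c * z).re = f z := by
  refine ⟨⟨f 1, -f Complex.I⟩, fun z => ?_⟩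
  have : z = z.re • (1 : ℂ) + z.im • Complex.I := by
    simp [Complex.re_add_im]
  conv_rhs => rw [this, map_add, map_smul, map_smul]
  simp
  ring

/-- A segment avoiding the origin lies in an open half-plane. -/
lemma exists_re_pos_of_segment {a b : ℂ} (h : (0 : ℂ) ∉ segment ℝ a b) :
    ∃ c : ℂ, 0 < (c * a).re ∧ 0 < (c * b).re := by
  have hc : IsCompact (segment ℝ a b) := by
    rw [← convexHull_pair]
    exact (Set.toFinite _).isCompact_convexHull ℝ
  obtain ⟨f, u, hu, hf⟩ := geometric_hahn_banach_point_closed (convex_segment a b) hc.isClosed h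
  obtain ⟨c, hcf⟩ := exists_re_mul_eq f
  rw [map_zero] at hu
  exact ⟨c, by rw [hcf]; linarith [hf a (left_mem_segment ℝ a b)],
    by rw [hcf]; linarith [hf b (right_mem_segment ℝ a b)]⟩

/-- Two disjoint segments are strictly separated by a linear functional. -/
lemma exists_re_pos_of_disjoint_segments {a b a' b' : ℂ}
    (h : Disjoint (segment ℝ a b) (segment ℝ a' b')) :
    ∃ c : ℂ, ∀ x ∈ segment ℝ a b, ∀ y ∈ segment ℝ a' b', 0 < (c * (y - x)).re := by
  have hc : ∀ a b : ℂ, IsCompact (segment ℝ a b) := fun a b => by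
    rw [← convexHull_pair]
    exact (Set.toFinite _).isCompact_convexHull ℝ
  obtain ⟨f, u, v, hu, huv, hv⟩ := geometric_hahn_banach_compact_closed (convex_segment a b)
    (hc a b) (convex_segment a' b') (hc a' b').isClosed h
  obtain ⟨c, hcf⟩ := exists_re_mul_eq f
  refine ⟨c, fun x hx y hy => ?_⟩
  rw [hcf, map_sub]
  linarith [hu x hx, hv y hy]

/-- In a non-degenerate parallelogram the diagonal divides the angle. -/
lemma arg_div_add_of_segment {a b : ℂ} (h : (0 : ℂ) ∉ segment ℝ a b) :
    Complex.arg ((a + b) / a) + Complex.arg (b / (a + b)) = Complex.arg (b / a) := by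
  obtain ⟨c, ha, hb⟩ := exists_re_pos_of_segment h
  refine LexPos.arg_div_add (c := c) (Or.inl ha) (Or.inl ?_) (Or.inl hb)
  rw [mul_add, Complex.add_re]
  positivity

lemma segment_subset_halfOpenSegment_union {a b : ℂ} {z : ℂ} (hz : z ∈ segment ℝ a b) :
    z ∈ halfOpenSegment a b ∨ z = b := by
  rw [segment_eq_image'] at hz
  obtain ⟨t, ht, rfl⟩ := hz
  rcases ht.2.lt_or_eq with h | rfl
  · exact Or.inl ⟨t, ⟨ht.1, h⟩, by simp⟩
  · right; simp

lemma left_mem_halfOpenSegment (a b : ℂ) : a ∈ halfOpenSegment a b :=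
  ⟨0, by simp, by simp⟩

lemma halfOpenSegment_subset_segment (a b : ℂ) : halfOpenSegment a b ⊆ segment ℝ a b := by
  rw [segment_eq_image']
  rintro _ ⟨t, ht, rfl⟩
  exact ⟨t, ⟨ht.1, ht.2.le⟩, by simp⟩

/-! ### Simple polygons and Hopf's secants -/

/-- A closed polygonal curve without self-intersections, given by the periodic sequence of its
`N` vertices. -/
structure IsSimplePolygon (N : ℕ) (p : ℕ → ℂ) : Prop where
  three_le : 3 ≤ N
  periodic : ∀ i, p (i + N) = p i
  disjoint : ∀ i < N, ∀ j < N, i ≠ j →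
    Disjoint (halfOpenSegment (p i) (p (i + 1))) (halfOpenSegment (p j) (p (j + 1)))

/-- The exterior angle at the vertex `p (i + 1)`. -/
noncomputable def extAngle (p : ℕ → ℂ) (i : ℕ) : ℝ :=
  Complex.arg ((p (i + 2) - p (i + 1)) / (p (i + 1) - p i))

lemma sum_range_add_of_periodic {N : ℕ} {f : ℕ → ℝ} (hf : ∀ i, f (i + N) = f i) (k : ℕ) :
    ∑ i ∈ Finset.range N, f (i + k) = ∑ i ∈ Finset.range N, f i := by
  induction k with
  | zero => simp
  | succ k ih =>
    rw [← ih]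
    have h1 := Finset.sum_range_succ (fun i => f (i + k)) N
    have h2 := Finset.sum_range_succ' (fun i => f (i + k)) N
    have h3 : f (N + k) = f (0 + k) := by rw [add_comm N, hf, zero_add]
    have h4 : ∀ i, f (i + (k + 1)) = f (i + 1 + k) := fun i => by congr 1; ring
    simp only [h4]
    linarith

namespace IsSimplePolygon

variable {N : ℕ} {p : ℕ → ℂ}

lemma apply_mod (h : IsSimplePolygon N p) (i : ℕ) : p (i % N) = p i := by
  have : Function.Periodic p N := h.periodic
  exact this.map_mod_nat i

lemma apply_mod_add (h : IsSimplePolygon N p) (i k : ℕ) : p (i % N + k) = p (i + k) := by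
  rw [← h.apply_mod (i % N + k), ← h.apply_mod (i + k), Nat.mod_add_mod]

lemma mod_eq_of_mem (h : IsSimplePolygon N p) {i j : ℕ} {z : ℂ}
    (hi : z ∈ halfOpenSegment (p i) (p (i + 1))) (hj : z ∈ halfOpenSegment (p j) (p (j + 1))) :
    i % N = j % N := by
  by_contra hne
  have hN : 0 < N := by have := h.three_le; omega
  have := h.disjoint _ (Nat.mod_lt i hN) _ (Nat.mod_lt j hN) hne
  rw [h.apply_mod, h.apply_mod, h.apply_mod_add, h.apply_mod_add] at this
  exact Set.disjoint_left.1 this hi hj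

lemma mod_eq_of_eq (h : IsSimplePolygon N p) {i j : ℕ} (hij : p i = p j) : i % N = j % N :=
  h.mod_eq_of_mem (left_mem_halfOpenSegment _ _) (hij ▸ left_mem_halfOpenSegment _ _)

lemma mod_eq_of_mem_segment (h : IsSimplePolygon N p) {i j : ℕ} {z : ℂ}
    (hi : z ∈ halfOpenSegment (p i) (p (i + 1))) (hj : z ∈ segment ℝ (p j) (p (j + 1))) :
    i % N = j % N ∨ z = p (j + 1) ∧ i % N = (j + 1) % N := by
  rcases segment_subset_halfOpenSegment_union hj with hj | rfl
  · exact Or.inl (h.mod_eq_of_mem hi hj)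
  · exact Or.inr ⟨rfl, h.mod_eq_of_mem hi (left_mem_halfOpenSegment _ _)⟩

lemma shift (h : IsSimplePolygon N p) (k : ℕ) : IsSimplePolygon N (fun i => p (i + k)) where
  three_le := h.three_le
  periodic i := by
    rw [show i + N + k = i + k + N by ring, h.periodic]
  disjoint i hi j hj hij := by
    rw [Set.disjoint_left]
    intro z hz1 hz2
    rw [show i + 1 + k = i + k + 1 by ring] at hz1
    rw [show j + 1 + k = j + k + 1 by ring] at hz2
    have := h.mod_eq_of_mem hz1 hz2
    have h2 : i % N = j % N := Nat.ModEq.add_right_cancel' k this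
    rw [Nat.mod_eq_of_lt hi, Nat.mod_eq_of_lt hj] at h2
    exact hij h2

/-- Closed edges without a common vertex are disjoint. `h3` excludes the first and last edge, which
share `p 0`. -/
lemma disjoint_segment (h : IsSimplePolygon N p) {i j : ℕ} (h1 : i + 2 ≤ j) (h2 : j + 1 ≤ N)
    (h3 : i ≠ 0 ∨ j + 1 ≠ N) :
    Disjoint (segment ℝ (p i) (p (i + 1))) (segment ℝ (p j) (p (j + 1))) := by
  have hmod : ∀ i j, i < j → j ≤ N → (i ≠ 0 ∨ j ≠ N) → i % N ≠ j % N := by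
    intro i j hij hj h0 he
    rcases hj.lt_or_eq with hj | rfl
    · rw [Nat.mod_eq_of_lt hj, Nat.mod_eq_of_lt (by omega)] at he
      omega
    · rw [Nat.mod_self, Nat.mod_eq_of_lt hij] at he
      omega
  rw [Set.disjoint_left]
  intro z hz1 hz2
  rcases segment_subset_halfOpenSegment_union hz1 with hz1 | rfl
  · rcases h.mod_eq_of_mem_segment hz1 hz2 with he | ⟨-, he⟩
    · exact hmod _ _ (by omega) (by omega) (by omega) he
    · exact hmod _ _ (by omega) (by omega) (by omega) he
  · rcases h.mod_eq_of_mem_segment (left_mem_halfOpenSegment _ _) hz2 with he | ⟨-, he⟩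
    · exact hmod _ _ (by omega) (by omega) (by omega) he
    · exact hmod _ _ (by omega) (by omega) (by omega) he

lemma succ_mod_ne (h : IsSimplePolygon N p) (i : ℕ) : i % N ≠ (i + 1) % N := by
  intro he
  have : 0 ≡ 1 [MOD N] := Nat.ModEq.add_left_cancel' i he
  have h3 := h.three_le
  rw [Nat.ModEq, Nat.zero_mod, Nat.mod_eq_of_lt (by omega)] at this
  omega

lemma succ_ne (h : IsSimplePolygon N p) (i : ℕ) : p i ≠ p (i + 1) :=
  fun he => h.succ_mod_ne i (h.mod_eq_of_eq he)

/-- A simple polygon has no spikes. -/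
lemma zero_notMem_segment (h : IsSimplePolygon N p) (i : ℕ) :
    (0 : ℂ) ∉ segment ℝ (p (i + 1) - p i) (p (i + 2) - p (i + 1)) := by
  rw [segment_eq_image]
  rintro ⟨t, ht, h0⟩
  simp only [Complex.real_smul, Complex.ofReal_sub, Complex.ofReal_one] at h0
  rcases ht.2.lt_or_eq with h1 | rfl
  · apply h.succ_mod_ne i
    -- The relation `h0` says that two consecutive edges reach the same point at the same parameter
    -- `t`.
    refine h.mod_eq_of_mem (z := p i + t * (p (i + 1) - p i)) ⟨t, ⟨ht.1, h1⟩, rfl⟩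
      ⟨t, ⟨ht.1, h1⟩, ?_⟩
    simp only
    linear_combination h0
  · apply h.succ_ne (i + 1)
    simp only [Complex.ofReal_one, sub_self, zero_mul, zero_add, one_mul] at h0
    exact (sub_eq_zero.1 h0).symm

lemma neg_segment {a b : ℂ} (h : (0 : ℂ) ∉ segment ℝ a b) : (0 : ℂ) ∉ segment ℝ (-b) (-a) := by
  rintro ⟨s, t, hs, ht, hst, h0⟩
  refine h ⟨t, s, ht, hs, by linarith, ?_⟩
  simp only [smul_neg] at h0
  linear_combination -h0

/-- The directions of the secants of two disjoint edges have a consistent choice of angle. -/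
lemma secant_cell (h : IsSimplePolygon N p) {i j : ℕ} (h1 : i + 2 ≤ j) (h2 : j + 1 ≤ N)
    (h3 : i ≠ 0 ∨ j + 1 ≠ N) :
    Complex.arg ((p j - p (i + 1)) / (p j - p i)) +
      Complex.arg ((p (j + 1) - p (i + 1)) / (p j - p (i + 1))) =
    Complex.arg ((p (j + 1) - p i) / (p j - p i)) +
      Complex.arg ((p (j + 1) - p (i + 1)) / (p (j + 1) - p i)) := by
  -- Separation puts all four secants into one open half-plane, so both ways round the cell give the
  -- argument of the same quotient.
  obtain ⟨c, hc⟩ := exists_re_pos_of_disjoint_segments (h.disjoint_segment h1 h2 h3)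
  have hl := left_mem_segment ℝ (p i) (p (i + 1))
  have hr := right_mem_segment ℝ (p i) (p (i + 1))
  have hl' := left_mem_segment ℝ (p j) (p (j + 1))
  have hr' := right_mem_segment ℝ (p j) (p (j + 1))
  rw [LexPos.arg_div_add (c := c) (Or.inl (hc _ hl _ hl')) (Or.inl (hc _ hr _ hl'))
      (Or.inl (hc _ hr _ hr')),
    LexPos.arg_div_add (c := c) (Or.inl (hc _ hl _ hl')) (Or.inl (hc _ hl _ hr'))
      (Or.inl (hc _ hr _ hr'))]

/-- Moving the secants along the first `k` edges, from the end point `p j` to `p (j + 1)`. -/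
lemma secant_row (h : IsSimplePolygon N p) {j k : ℕ} (h1 : k + 2 ≤ j) (h2 : j + 1 ≤ N) :
    ∑ i ∈ Finset.range k, Complex.arg ((p j - p (i + 2)) / (p j - p (i + 1))) +
      Complex.arg ((p (j + 1) - p (k + 1)) / (p j - p (k + 1))) =
    Complex.arg ((p (j + 1) - p 1) / (p j - p 1)) +
      ∑ i ∈ Finset.range k, Complex.arg ((p (j + 1) - p (i + 2)) / (p (j + 1) - p (i + 1))) := by
  induction k with
  | zero => simp
  | succ k ih =>
    rw [Finset.sum_range_succ, Finset.sum_range_succ]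
    have := ih (by omega)
    have := h.secant_cell (i := k + 1) (j := j) (by omega) h2 (by omega)
    linarith

/-- The degenerate cell on the diagonal: the secant is the sum of two consecutive edge vectors and
divides the angle between them. -/
lemma secant_triangle (h : IsSimplePolygon N p) (i : ℕ) :
    Complex.arg ((p (i + 2) - p i) / (p (i + 1) - p i)) +
      Complex.arg ((p (i + 2) - p (i + 1)) / (p (i + 2) - p i)) = extAngle p i := by
  have := arg_div_add_of_segment (h.zero_notMem_segment i)
  rw [extAngle, ← this]
  ring_nf

/-- The path of secants along the diagonal compared with the one around the corner. -/
lemma sum_extAngle_eq (h : IsSimplePolygon N p) {m : ℕ} (hm : m + 2 ≤ N) :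
    ∑ i ∈ Finset.range m, extAngle p (i + 1) =
    ∑ j ∈ Finset.range m, Complex.arg ((p (j + 3) - p 1) / (p (j + 2) - p 1)) +
      ∑ i ∈ Finset.range m, Complex.arg ((p (m + 2) - p (i + 2)) / (p (m + 2) - p (i + 1))) := by
  induction m with
  | zero => simp
  | succ m ih =>
    rw [Finset.sum_range_succ, Finset.sum_range_succ, Finset.sum_range_succ, ih (by omega)]
    have h1 := h.secant_row (j := m + 2) (k := m) (by omega) (by omega)
    have h2 := h.secant_triangle (m + 1)
    simp only [add_assoc, Nat.reduceAdd] at h1 h2 ⊢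
    linarith

/-- Cells are added one at a time, starting from the triangle at the diagonal, which yields the
exterior angle. The bound on `m` stops short of the cell of the first and last edges, where
separation fails. -/
lemma secant_column (h : IsSimplePolygon N p) {m : ℕ} (hm : m + 3 ≤ N) :
    ∑ j ∈ Finset.range (m + 1), Complex.arg ((p (j + 2) - p 0) / (p (j + 1) - p 0)) +
      Complex.arg ((p (m + 2) - p 1) / (p (m + 2) - p 0)) =
    extAngle p 0 + ∑ j ∈ Finset.range m, Complex.arg ((p (j + 3) - p 1) / (p (j + 2) - p 1)) := by
  induction m with
  | zero => simpa using h.secant_triangle 0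
  | succ m ih =>
    have h1 := ih (by omega)
    have h2 := h.secant_cell (i := 0) (j := m + 2) (by omega) (by omega) (by omega)
    rw [Finset.sum_range_succ,
      Finset.sum_range_succ (fun j => Complex.arg ((p (j + 3) - p 1) / (p (j + 2) - p 1)))]
    simp only [add_assoc, Nat.reduceAdd, zero_add] at h1 h2 ⊢
    linarith

/-- The exterior angles in terms of the secants through the vertex `p 0`. -/
lemma sum_extAngle_eq_secants (h : IsSimplePolygon N p) :
    ∑ i ∈ Finset.range N, extAngle p i =
    2 * ∑ j ∈ Finset.range (N - 2), Complex.arg ((p (j + 2) - p 0) / (p (j + 1) - p 0)) +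
      2 * Complex.arg ((p 0 - p 1) / (p (N - 1) - p 0)) := by
  obtain ⟨m, rfl⟩ : ∃ m, N = m + 3 := ⟨N - 3, by have := h.three_le; omega⟩
  have hp0 : p (m + 3) = p 0 := by simpa using h.periodic 0
  have hp1 : p (m + 4) = p 1 := by simpa [add_comm, add_left_comm] using h.periodic 1
  have h1 := h.sum_extAngle_eq (m := m + 1) (by omega)
  have h2 := h.secant_column (m := m) le_rfl
  -- The missing cell is replaced by the triangle at `p 0`; the secant from `p 1` to `p N = p 0` is
  -- now an edge traversed backwards.
  have h3 : Complex.arg ((p (m + 2) - p 1) / (p (m + 2) - p 0)) +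
      Complex.arg ((p 0 - p 1) / (p (m + 2) - p 1)) =
      Complex.arg ((p 0 - p 1) / (p (m + 2) - p 0)) := by
    have := neg_segment (h.zero_notMem_segment (m + 2))
    simp only [add_assoc, Nat.reduceAdd, hp0, hp1, neg_sub] at this
    rw [segment_symm] at this
    rw [← arg_div_add_of_segment this]
    ring_nf
  have h4 : extAngle p (m + 2) = Complex.arg ((p 0 - p 1) / (p (m + 2) - p 0)) := by
    rw [extAngle, hp0, hp1, ← neg_sub (p 0) (p 1), ← neg_sub (p (m + 2)) (p 0), neg_div_neg_eq]
  rw [Finset.sum_range_succ, h4, Finset.sum_range_succ']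
  simp only [add_assoc, Nat.reduceAdd, Nat.reduceSubDiff, hp0] at h1 h2 h3 h4 ⊢
  -- Secants ending at `p N = p 0` are reversed secants from `p 0` and turn by the same angles:
  -- hence the factor `2`.
  have h5 : ∀ i, Complex.arg ((p 0 - p (i + 2)) / (p 0 - p (i + 1))) =
      Complex.arg ((p (i + 2) - p 0) / (p (i + 1) - p 0)) := fun i => by
    rw [← neg_sub (p (i + 2)), ← neg_sub (p (i + 1)), neg_div_neg_eq]
  simp only [h5] at h1
  rw [Finset.sum_range_succ (fun j => Complex.arg ((p (j + 3) - p 1) / (p (j + 2) - p 1)))] at h1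
  simp only [hp0] at h1
  linarith

end IsSimplePolygon

lemma div_im_eq_planeCross (a b : ℂ) : (a / b).im = planeCross b a / Complex.normSq b := by
  rw [Complex.div_im, planeCross]
  ring

/-! ### Total turning, read off at an extreme vertex -/

namespace IsSimplePolygon

variable {N : ℕ} {p : ℕ → ℂ}

/-- The secants through an extreme `p 0` lie in a half-plane, so their angles telescope to `θ = arg
(a / b)`, with `b` and `a` pointing to the next and previous vertex. The remaining argument is `π -
θ` or `-π - θ`, depending on the turn at `p 0`; doubling the sum gives the two values. -/
lemma sum_extAngle_of_extreme_zero (h : IsSimplePolygon N p) {c : ℂ}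
    (hc : ∀ i, p i ≠ p 0 → LexPos (c * (p i - p 0))) :
    (0 < planeCross (p 0 - p (N - 1)) (p 1 - p 0) ∧
      ∑ i ∈ Finset.range N, extAngle p i = 2 * π) ∨
    (planeCross (p 0 - p (N - 1)) (p 1 - p 0) < 0 ∧
      ∑ i ∈ Finset.range N, extAngle p i = -(2 * π)) := by
  have hN := h.three_le
  have hpos : ∀ i, 0 < i → i < N → LexPos (c * (p i - p 0)) := by
    intro i hi hiN
    apply hc
    intro he
    have := h.mod_eq_of_eq he
    rw [Nat.mod_eq_of_lt hiN, Nat.zero_mod] at this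
    omega
  have hsum : ∀ m, m + 1 < N →
      ∑ j ∈ Finset.range m, Complex.arg ((p (j + 2) - p 0) / (p (j + 1) - p 0)) =
      Complex.arg ((p (m + 1) - p 0) / (p 1 - p 0)) := by
    intro m hm
    induction m with
    | zero =>
      have := sub_ne_zero.2 (h.succ_ne 0).symm
      simp [div_self this]
    | succ m ih =>
      rw [Finset.sum_range_succ, ih (by omega)]
      exact LexPos.arg_div_add (hpos _ (by omega) (by omega)) (hpos _ (by omega) (by omega))
        (hpos _ (by omega) (by omega))
  have hs := h.sum_extAngle_eq_secants
  rw [hsum _ (by omega), show N - 2 + 1 = N - 1 by omega] at hs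
  set a := p (N - 1) - p 0 with ha_def
  set b := p 1 - p 0 with hb_def
  have ha : LexPos (c * a) := hpos _ (by omega) (by omega)
  have hb : LexPos (c * b) := hpos _ (by omega) (by omega)
  have hc0 : c ≠ 0 := left_ne_zero_of_mul ha.ne_zero
  have ha0 : a ≠ 0 := right_ne_zero_of_mul ha.ne_zero
  have hb0 : b ≠ 0 := right_ne_zero_of_mul hb.ne_zero
  have hcr : planeCross (p 0 - p (N - 1)) b = planeCross b a := by
    rw [ha_def]; simp only [planeCross, Complex.sub_re, Complex.sub_im]; ring
  rw [hcr]
  have hnb := Complex.normSq_pos.2 hb0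
  have hna := Complex.normSq_pos.2 ha0
  have him := div_im_eq_planeCross a b
  have hinv : (p 0 - p 1) / a = -(a / b)⁻¹ := by rw [inv_div, hb_def]; ring
  have him' : ((a / b)⁻¹).im = - planeCross b a / Complex.normSq a := by
    rw [inv_div, div_im_eq_planeCross]; simp only [planeCross]; ring
  rw [hinv] at hs
  rcases lt_trichotomy (planeCross b a) 0 with hlt | heq | hgt
  · right
    refine ⟨hlt, ?_⟩
    have h1 : 0 < ((a / b)⁻¹).im := by rw [him']; apply div_pos <;> linarith
    have h2 : Complex.arg (a / b) ≠ π := by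
      rw [Ne, Complex.arg_eq_pi_iff]
      rintro ⟨-, h0⟩
      rw [him] at h0
      exact (div_neg_of_neg_of_pos hlt hnb).ne h0
    rw [Complex.arg_neg_eq_arg_sub_pi_of_im_pos h1, Complex.arg_inv, if_neg h2] at hs
    rw [hs]; ring
  · exfalso
    have h0 : (a / b).im = 0 := by rw [him, heq, zero_div]
    have hab : a = ((a / b).re : ℂ) * b := by
      have : a / b = ((a / b).re : ℂ) := by
        apply Complex.ext <;> simp [h0]
      rw [← this, div_mul_cancel₀ _ hb0]
    have hsp := h.zero_notMem_segment (N - 1)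
    have hpN : p (N - 1 + 1) = p 0 := by
      rw [show N - 1 + 1 = 0 + N by omega, h.periodic]
    have hpN1 : p (N - 1 + 2) = p 1 := by
      rw [show N - 1 + 2 = 1 + N by omega, h.periodic]
    rw [hpN, hpN1] at hsp
    obtain ⟨d, hd1, hd2⟩ := exists_re_pos_of_segment hsp
    generalize (a / b).re = r at hab
    -- If `a` and `b` are parallel, absence of spikes makes them opposite, whereas extremality puts
    -- them on the same side.
    have hr : r < 0 := by
      rw [← neg_sub, ← ha_def, ← hb_def] at *
      have e : d * -a = ((-r : ℝ) : ℂ) * (d * b) := by rw [hab]; push_cast; ring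
      rw [e, Complex.re_ofReal_mul] at hd1
      nlinarith
    have e : c * a = (r : ℂ) * (c * b) := by rw [hab]; ring
    rw [LexPos, e, Complex.re_ofReal_mul, Complex.im_ofReal_mul] at ha
    rcases hb with hb | ⟨hb, hb'⟩
    · rcases ha with ha | ⟨ha, -⟩ <;> nlinarith
    · rcases ha with ha | ⟨-, ha⟩ <;> nlinarith
  · left
    refine ⟨hgt, ?_⟩
    have h1 : ((a / b)⁻¹).im < 0 := by
      rw [him']; apply div_neg_of_neg_of_pos <;> linarith
    have h2 : Complex.arg (a / b) ≠ π := by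
      rw [Ne, Complex.arg_eq_pi_iff]
      rintro ⟨-, h0⟩
      rw [him] at h0
      exact (div_pos hgt hnb).ne' h0
    rw [Complex.arg_neg_eq_arg_add_pi_of_im_neg h1, Complex.arg_inv, if_neg h2] at hs
    rw [hs]; ring

lemma extAngle_periodic (h : IsSimplePolygon N p) (i : ℕ) :
    extAngle p (i + N) = extAngle p i := by
  rw [extAngle, extAngle, show i + N + 2 = i + 2 + N by ring, show i + N + 1 = i + 1 + N by ring,
    h.periodic, h.periodic, h.periodic]

/-- The exterior angles of a simple polygon add up to a full turn, whose sense is that of the turn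
at any extreme vertex. -/
theorem sum_extAngle_of_extreme (h : IsSimplePolygon N p) {c : ℂ} {k : ℕ}
    (hc : ∀ i, p i ≠ p (k + 1) → LexPos (c * (p i - p (k + 1)))) :
    (0 < planeCross (p (k + 1) - p k) (p (k + 2) - p (k + 1)) ∧
      ∑ i ∈ Finset.range N, extAngle p i = 2 * π) ∨
    (planeCross (p (k + 1) - p k) (p (k + 2) - p (k + 1)) < 0 ∧
      ∑ i ∈ Finset.range N, extAngle p i = -(2 * π)) := by
  have hN := h.three_le
  have := (h.shift (k + 1)).sum_extAngle_of_extreme_zero (c := c) (fun i hi => by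
    simp only [zero_add] at hi ⊢
    exact hc _ hi)
  have e1 : p (N - 1 + (k + 1)) = p k := by
    rw [show N - 1 + (k + 1) = k + N by omega, h.periodic]
  have e2 : ∀ i, extAngle (fun i => p (i + (k + 1))) i = extAngle p (i + (k + 1)) := fun i => by
    simp only [extAngle]
    rw [show i + 2 + (k + 1) = i + (k + 1) + 2 by ring,
      show i + 1 + (k + 1) = i + (k + 1) + 1 by ring]
  simp only [e1, e2, zero_add] at this
  rw [sum_range_add_of_periodic h.extAngle_periodic, show 1 + (k + 1) = k + 2 by ring] at this
  exact this

end IsSimplePolygon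

/-! ### Signed area and subpolygons -/

/-- Twice the signed area of the closed polygon with vertices `p 0, …, p (N - 1)`. -/
def signedArea (N : ℕ) (p : ℕ → ℂ) : ℝ := ∑ i ∈ Finset.range N, planeCross (p i) (p (i + 1))

/-- The closed polygon with the vertices `p a, …, p (a + m)`. -/
def subpolygon (p : ℕ → ℂ) (a m : ℕ) : ℕ → ℂ := fun i => p (a + i % (m + 1))

lemma subpolygon_apply {p : ℕ → ℂ} {a m i : ℕ} (hi : i ≤ m) : subpolygon p a m i = p (a + i) := by
  rw [subpolygon, Nat.mod_eq_of_lt (by omega)]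

lemma subpolygon_add {p : ℕ → ℂ} {a m i : ℕ} (hi : i ≤ m) :
    subpolygon p a m (m + 1 + i) = p (a + i) := by
  rw [subpolygon, Nat.add_mod_left, Nat.mod_eq_of_lt (by omega)]

lemma signedArea_subpolygon (p : ℕ → ℂ) (a m : ℕ) :
    signedArea (m + 1) (subpolygon p a m) =
      ∑ i ∈ Finset.range m, planeCross (p (a + i)) (p (a + i + 1)) +
        planeCross (p (a + m)) (p a) := by
  rw [signedArea, Finset.sum_range_succ, subpolygon_apply le_rfl,
    subpolygon_add (i := 0) (Nat.zero_le m), add_zero]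
  congr 1
  refine Finset.sum_congr rfl fun i hi => ?_
  have := Finset.mem_range.1 hi
  rw [subpolygon_apply this.le, subpolygon_apply this, add_assoc]

/-- A path that leaves the open first quadrant crosses one of the two half-axes. -/
lemma exists_mem_axes {s t s' t' : ℝ} (hs : 0 < s) (ht : 0 < t) (h : s' ≤ 0 ∨ t' ≤ 0) :
    ∃ r : ℝ, 0 < r ∧ r ≤ 1 ∧ ((s + r * (s' - s) = 0 ∧ 0 ≤ t + r * (t' - t)) ∨
      (t + r * (t' - t) = 0 ∧ 0 ≤ s + r * (s' - s))) := by
  -- Where the smaller coordinate first becomes zero is irrelevant: at any zero of the minimum the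
  -- other coordinate is non-negative.
  have hf : ContinuousOn (fun r : ℝ => min (s + r * (s' - s)) (t + r * (t' - t)))
      (Set.Icc 0 1) := by fun_prop
  have := intermediate_value_Icc' zero_le_one hf (show (0 : ℝ) ∈ _ from by
    constructor
    · simpa using h
    · simpa using ⟨hs.le, ht.le⟩)
  obtain ⟨r, hr, h0⟩ := this
  simp only at h0
  have hr0 : r ≠ 0 := by
    rintro rfl
    simp only [zero_mul, add_zero] at h0
    have := lt_min hs ht
    linarith
  refine ⟨r, lt_of_le_of_ne hr.1 hr0.symm, hr.2, ?_⟩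
  rcases min_choice (s + r * (s' - s)) (t + r * (t' - t)) with hm | hm
  · left
    exact ⟨by linarith, by rw [← h0]; exact min_le_right _ _⟩
  · right
    exact ⟨by linarith, by rw [← h0]; exact min_le_left _ _⟩

/-- Coordinates of a point in the basis given by two linearly independent vectors. -/
lemma planeCross_basis (w u z : ℂ) :
    (planeCross w u : ℂ) * z = planeCross z u * w + planeCross w z * u := by
  apply Complex.ext <;>
  · simp only [planeCross, Complex.add_re, Complex.add_im, Complex.re_ofReal_mul,
      Complex.im_ofReal_mul]
    ring

namespace IsSimplePolygon

variable {N : ℕ} {p : ℕ → ℂ}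

/-- All edges but the closing chord are inherited. `hd` covers only the open chord; its starting
vertex is handled by simplicity of `p`. -/
lemma subpolygon (h : IsSimplePolygon N p) {a m : ℕ} (hm : 2 ≤ m) (hmN : m < N)
    (hd : ∀ i < N, ∀ x ∈ openSegment ℝ (p (a + m)) (p a), x ∉ halfOpenSegment (p i) (p (i + 1))) :
    IsSimplePolygon (m + 1) (subpolygon p a m) where
  three_le := by omega
  periodic i := by simp [_root_.subpolygon]
  disjoint := by
    have hd' : ∀ i, ∀ x ∈ openSegment ℝ (p (a + m)) (p a),
        x ∉ halfOpenSegment (p i) (p (i + 1)) := fun i x hx hx' => by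
      refine hd (i % N) (Nat.mod_lt _ (by omega)) x hx ?_
      rwa [h.apply_mod, h.apply_mod_add]
    have hmod : ∀ i ≤ m, ∀ j ≤ m, (a + i) % N = (a + j) % N → i = j := fun i hi j hj he => by
      have : i ≡ j [MOD N] := Nat.ModEq.add_left_cancel' a he
      rwa [Nat.ModEq, Nat.mod_eq_of_lt (by omega), Nat.mod_eq_of_lt (by omega)] at this
    have hlast : ∀ i < m, Disjoint (halfOpenSegment (p (a + i)) (p (a + i + 1)))
        (halfOpenSegment (p (a + m)) (p a)) := by
      intro i hi
      rw [Set.disjoint_left]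
      rintro z hz ⟨t, ht, rfl⟩
      rcases ht.1.lt_or_eq with h0 | h0
      · refine hd' _ _ ?_ hz
        rw [openSegment_eq_image']
        exact ⟨t, ⟨h0, ht.2⟩, by simp⟩
      · simp only [← h0, Complex.ofReal_zero, zero_mul, add_zero] at hz
        have := hmod _ hi.le _ le_rfl (h.mod_eq_of_mem hz (left_mem_halfOpenSegment _ _))
        omega
    intro i hi j hj hij
    rw [subpolygon_apply (by omega : i ≤ m), subpolygon_apply (by omega : j ≤ m)]
    rcases (show i ≤ m by omega).lt_or_eq with hi' | rfl
    · rw [subpolygon_apply (by omega : i + 1 ≤ m)]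
      rcases (show j ≤ m by omega).lt_or_eq with hj' | rfl
      · rw [subpolygon_apply (by omega : j + 1 ≤ m), Set.disjoint_left]
        intro z hz hz'
        exact hij (hmod _ hi'.le _ hj'.le (h.mod_eq_of_mem hz hz'))
      · rw [subpolygon_add (i := 0) (Nat.zero_le _)]
        exact hlast i hi'
    · rw [subpolygon_apply (by omega : j + 1 ≤ i), subpolygon_add (i := 0) (Nat.zero_le _)]
      exact (hlast j (by omega)).symm

/-- Minimising lexicographically breaks ties among vertices on a supporting line, which is why
`LexPos` is used instead of an open half-plane. -/
lemma exists_extreme (h : IsSimplePolygon N p) {c : ℂ} (hc : c ≠ 0) :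
    ∃ k < N, ∀ i, p i ≠ p k → LexPos (c * (p i - p k)) := by
  have hN := h.three_le
  obtain ⟨k, hk, hmin⟩ := Finset.exists_min_image (Finset.range N)
    (fun i => toLex ((c * p i).re, (c * p i).im)) ⟨0, by simp; omega⟩
  refine ⟨k, Finset.mem_range.1 hk, fun i hi => ?_⟩
  have := hmin (i % N) (Finset.mem_range.2 (Nat.mod_lt _ (by omega)))
  rw [h.apply_mod, Prod.Lex.toLex_le_toLex] at this
  rw [LexPos, mul_sub, Complex.sub_re, Complex.sub_im]
  rcases this with h1 | ⟨h1, h2⟩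
  · left; simpa using h1
  · right
    refine ⟨sub_eq_zero.2 h1.symm, sub_pos.2 (lt_of_le_of_ne h2 fun he => hi ?_)⟩
    exact mul_left_cancel₀ hc (Complex.ext h1.symm he.symm)

end IsSimplePolygon

/-! ### The corner triangle: finding a diagonal -/

/-- Twice the signed area of the triangle cut off at the vertex `p 0`. -/
def cornerArea (N : ℕ) (p : ℕ → ℂ) : ℝ := planeCross (p 1 - p 0) (p (N - 1) - p 0)

/-- The coordinate along the edge from `p 0` to `p 1`, scaled by `cornerArea`. -/
def nextCoord (N : ℕ) (p : ℕ → ℂ) (z : ℂ) : ℝ := planeCross (z - p 0) (p (N - 1) - p 0)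

/-- The coordinate along the edge from `p 0` to `p (N - 1)`, scaled by `cornerArea`. -/
def prevCoord (p : ℕ → ℂ) (z : ℂ) : ℝ := planeCross (p 1 - p 0) (z - p 0)

section Corner

variable {N : ℕ} {p : ℕ → ℂ}

lemma nextCoord_add_mul (x y : ℂ) (r : ℝ) : nextCoord N p (x + r * (y - x)) =
    nextCoord N p x + r * (nextCoord N p y - nextCoord N p x) := by
  simp only [nextCoord, planeCross, Complex.add_re, Complex.add_im, Complex.re_ofReal_mul,
    Complex.im_ofReal_mul, Complex.sub_re, Complex.sub_im]
  ring

lemma prevCoord_add_mul (x y : ℂ) (r : ℝ) : prevCoord p (x + r * (y - x)) =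
    prevCoord p x + r * (prevCoord p y - prevCoord p x) := by
  simp only [prevCoord, planeCross, Complex.add_re, Complex.add_im, Complex.re_ofReal_mul,
    Complex.im_ofReal_mul, Complex.sub_re, Complex.sub_im]
  ring

@[simp] lemma nextCoord_zero : nextCoord N p (p 0) = 0 := by simp [nextCoord, planeCross]

@[simp] lemma prevCoord_zero : prevCoord p (p 0) = 0 := by simp [prevCoord, planeCross]

@[simp] lemma nextCoord_one : nextCoord N p (p 1) = cornerArea N p := rfl

@[simp] lemma prevCoord_one : prevCoord p (p 1) = 0 := by
  simp [prevCoord, planeCross]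

@[simp] lemma nextCoord_last : nextCoord N p (p (N - 1)) = 0 := by
  simp [nextCoord, planeCross]

@[simp] lemma prevCoord_last : prevCoord p (p (N - 1)) = cornerArea N p := rfl

lemma eq_corner_combination (hD : 0 < cornerArea N p) (z : ℂ) :
    z = p 0 + (nextCoord N p z / cornerArea N p : ℝ) * (p 1 - p 0) +
      (prevCoord p z / cornerArea N p : ℝ) * (p (N - 1) - p 0) := by
  have h1 := planeCross_basis (p 1 - p 0) (p (N - 1) - p 0) (z - p 0)
  have h2 : (cornerArea N p : ℂ) ≠ 0 := Complex.ofReal_ne_zero.2 hD.ne'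
  change (cornerArea N p : ℂ) * _ = nextCoord N p z * _ + prevCoord p z * _ at h1
  push_cast
  field_simp
  linear_combination h1

lemma eq_of_coords_eq (hD : 0 < cornerArea N p) {x y : ℂ} (h1 : nextCoord N p x = nextCoord N p y)
    (h2 : prevCoord p x = prevCoord p y) : x = y := by
  rw [eq_corner_combination hD x, eq_corner_combination hD y, h1, h2]

lemma mem_halfOpenSegment_of_coords (hD : 0 < cornerArea N p) {z : ℂ} (h0 : prevCoord p z = 0)
    (h1 : 0 ≤ nextCoord N p z) (h2 : nextCoord N p z < cornerArea N p) :
    z ∈ halfOpenSegment (p 0) (p 1) := by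
  refine ⟨nextCoord N p z / cornerArea N p, ⟨by positivity, (div_lt_one hD).2 h2⟩, ?_⟩
  refine Eq.trans ?_ (eq_corner_combination hD z).symm
  rw [h0]; simp

lemma mem_segment_of_coords (hD : 0 < cornerArea N p) {z : ℂ} (h0 : nextCoord N p z = 0)
    (h1 : 0 ≤ prevCoord p z) (h2 : prevCoord p z ≤ cornerArea N p) :
    z ∈ segment ℝ (p (N - 1)) (p 0) := by
  rw [segment_symm, segment_eq_image']
  refine ⟨prevCoord p z / cornerArea N p, ⟨by positivity, (div_le_one hD).2 h2⟩, ?_⟩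
  refine Eq.trans ?_ (eq_corner_combination hD z).symm
  rw [h0]; simp

/-- The triangle with vertices `p 0`, `p 1` and `p (N - 1)`. -/
def InCorner (N : ℕ) (p : ℕ → ℂ) (z : ℂ) : Prop :=
  0 ≤ nextCoord N p z ∧ 0 ≤ prevCoord p z ∧ nextCoord N p z + prevCoord p z ≤ cornerArea N p

namespace IsSimplePolygon

lemma apply_last_succ (h : IsSimplePolygon N p) : p (N - 1 + 1) = p 0 := by
  have := h.three_le
  rw [show N - 1 + 1 = 0 + N by omega, h.periodic]

lemma mod_eq_of_nextCoord_eq_zero (h : IsSimplePolygon N p) (hD : 0 < cornerArea N p) {z : ℂ}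
    {i : ℕ} (hz : z ∈ halfOpenSegment (p i) (p (i + 1))) (h0 : nextCoord N p z = 0)
    (h1 : 0 ≤ prevCoord p z) (h2 : prevCoord p z ≤ cornerArea N p) :
    i % N = N - 1 ∨ i % N = 0 := by
  have hN := h.three_le
  have hm := mem_segment_of_coords hD h0 h1 h2
  rw [← h.apply_last_succ] at hm
  rcases h.mod_eq_of_mem_segment hz hm with he | ⟨-, he⟩
  · left; rw [he, Nat.mod_eq_of_lt (by omega)]
  · right; rw [he, show N - 1 + 1 = N by omega, Nat.mod_self]

/-- An edge not incident with `p 0` that enters the open corner at `p 0` and ends below the line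
through `p 1` and `p (N - 1)` has its end point in the corner. -/
lemma coords_pos_of_edge (h : IsSimplePolygon N p) (hD : 0 < cornerArea N p) {i : ℕ}
    (hi : 1 ≤ i) (hiN : i + 2 ≤ N) {x a : ℂ} (hx : x ∈ segment ℝ (p i) (p (i + 1)))
    (ha : a ∈ segment ℝ (p i) (p (i + 1)))
    (hs : 0 < nextCoord N p x) (ht : 0 < prevCoord p x)
    (hst : nextCoord N p x + prevCoord p x ≤ cornerArea N p)
    (hst' : nextCoord N p a + prevCoord p a < cornerArea N p) :
    0 < nextCoord N p a ∧ 0 < prevCoord p a := by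
  by_contra hcon
  have hle : nextCoord N p a ≤ 0 ∨ prevCoord p a ≤ 0 := by
    by_contra! hc
    exact hcon hc
  obtain ⟨r, hr0, hr1, hr⟩ := exists_mem_axes hs ht hle
  rw [← nextCoord_add_mul, ← prevCoord_add_mul] at hr
  have hlt : nextCoord N p (x + r * (a - x)) + prevCoord p (x + r * (a - x)) <
      cornerArea N p := by
    rw [nextCoord_add_mul, prevCoord_add_mul]
    nlinarith
  have hy : x + r * (a - x) ∈ segment ℝ (p i) (p (i + 1)) := by
    refine (convex_segment _ _).segment_subset hx ha ?_
    rw [segment_eq_image']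
    exact ⟨r, ⟨hr0.le, hr1⟩, by simp⟩
  generalize x + r * (a - x) = y at hr hlt hy
  rcases hr with ⟨h0, h1⟩ | ⟨h0, h1⟩
  · rcases segment_subset_halfOpenSegment_union hy with hy | rfl
    · rcases h.mod_eq_of_nextCoord_eq_zero hD hy h0 h1 (by linarith) with he | he <;>
        rw [Nat.mod_eq_of_lt (by omega)] at he <;> omega
    · rcases h.mod_eq_of_nextCoord_eq_zero hD (left_mem_halfOpenSegment _ _) h0 h1 (by linarith)
        with he | he <;> rw [Nat.mod_eq_of_lt (by omega)] at he
      · rw [he, nextCoord_last, prevCoord_last] at hlt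
        linarith
      · omega
  · have hm := mem_halfOpenSegment_of_coords hD h0 h1 (by linarith)
    rcases h.mod_eq_of_mem_segment (i := 0) hm hy with he | ⟨-, he⟩ <;>
      rw [Nat.zero_mod, Nat.mod_eq_of_lt (by omega)] at he <;> omega

lemma exists_param {a b z : ℂ} (hz : z ∈ halfOpenSegment a b) :
    ∃ r : ℝ, 0 ≤ r ∧ r < 1 ∧ z = a + r * (b - a) := by
  obtain ⟨r, hr, rfl⟩ := hz
  exact ⟨r, hr.1, hr.2, rfl⟩

/-- A point in the open corner does not lie on the two edges incident with `p 0`. -/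
lemma edge_index_of_coords_pos (h : IsSimplePolygon N p) {i : ℕ} (hi : i < N) {x : ℂ}
    (hx : x ∈ halfOpenSegment (p i) (p (i + 1)))
    (hs : 0 < nextCoord N p x) (ht : 0 < prevCoord p x) : 1 ≤ i ∧ i + 2 ≤ N := by
  obtain ⟨r, hr0, hr1, rfl⟩ := exists_param hx
  rw [nextCoord_add_mul] at hs
  rw [prevCoord_add_mul] at ht
  constructor
  · by_contra! h0
    obtain rfl : i = 0 := by omega
    simp at ht
  · by_contra! h0
    obtain rfl : i = N - 1 := by omega
    rw [h.apply_last_succ] at hs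
    simp at hs

/-- A vertex of the corner triangle farthest from the opposite side sees `p 0`. -/
lemma diagonal_disjoint (h : IsSimplePolygon N p) (hD : 0 < cornerArea N p) {k : ℕ}
    (hs : 0 < nextCoord N p (p k)) (ht : 0 < prevCoord p (p k))
    (hst : nextCoord N p (p k) + prevCoord p (p k) ≤ cornerArea N p)
    (hmin : ∀ j, 2 ≤ j → j + 2 ≤ N → InCorner N p (p j) →
      nextCoord N p (p k) + prevCoord p (p k) ≤ nextCoord N p (p j) + prevCoord p (p j)) :
    ∀ i < N, ∀ x ∈ openSegment ℝ (p 0) (p k), x ∉ halfOpenSegment (p i) (p (i + 1)) := by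
  rintro i hi x hx hx'
  rw [openSegment_eq_image'] at hx
  obtain ⟨r, ⟨hr0, hr1⟩, hr⟩ := hx
  simp only [Complex.real_smul] at hr
  have hxs : nextCoord N p x = r * nextCoord N p (p k) := by
    rw [← hr, nextCoord_add_mul]; simp
  have hxt : prevCoord p x = r * prevCoord p (p k) := by
    rw [← hr, prevCoord_add_mul]; simp
  have hs' : 0 < nextCoord N p x := by rw [hxs]; positivity
  have ht' : 0 < prevCoord p x := by rw [hxt]; positivity
  have hlt : nextCoord N p x + prevCoord p x < nextCoord N p (p k) + prevCoord p (p k) := by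
    rw [hxs, hxt]; nlinarith
  obtain ⟨hi1, hi2⟩ := h.edge_index_of_coords_pos hi hx' hs' ht'
  -- An end of the edge no higher than `x` would be a vertex in the corner below `p k`, against
  -- minimality. So both ends lie above `x`, which is impossible for a point of the edge.
  have key : ∀ j, i ≤ j → j ≤ i + 1 → p j ∈ segment ℝ (p i) (p (i + 1)) →
      nextCoord N p x + prevCoord p x < nextCoord N p (p j) + prevCoord p (p j) := by
    intro j hij hji hj
    by_contra! hle
    obtain ⟨h1, h2⟩ := h.coords_pos_of_edge hD hi1 hi2 (halfOpenSegment_subset_segment _ _ hx') hj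
      hs' ht' (by linarith) (by linarith)
    have hj1 : j ≠ 1 := by
      rintro rfl
      simp at h2
    have hjN : j ≠ N - 1 := by
      rintro rfl
      simp at h1
    have := hmin j (by omega) (by omega) ⟨h1.le, h2.le, by linarith⟩
    linarith
  have k1 := key i le_rfl (by omega) (left_mem_segment _ _ _)
  have k2 := key (i + 1) (by omega) le_rfl (right_mem_segment _ _ _)
  obtain ⟨q, hq0, hq1, rfl⟩ := exists_param hx'
  rw [nextCoord_add_mul, prevCoord_add_mul] at k1 k2
  nlinarith

/-- If the corner triangle contains no other vertices, then it can be cut off. -/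
lemma ear_disjoint (h : IsSimplePolygon N p) (hD : 0 < cornerArea N p) (hN : 4 ≤ N)
    (hempty : ∀ j, 2 ≤ j → j + 2 ≤ N → ¬ InCorner N p (p j)) :
    ∀ i < N, ∀ x ∈ openSegment ℝ (p (N - 1)) (p 1), x ∉ halfOpenSegment (p i) (p (i + 1)) := by
  rintro i hi x hx hx'
  rw [openSegment_eq_image'] at hx
  obtain ⟨r, ⟨hr0, hr1⟩, hr⟩ := hx
  simp only [Complex.real_smul] at hr
  have hxs : nextCoord N p x = r * cornerArea N p := by
    rw [← hr, nextCoord_add_mul]; simp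
  have hxt : prevCoord p x = (1 - r) * cornerArea N p := by
    rw [← hr, prevCoord_add_mul]; simp; ring
  have hs' : 0 < nextCoord N p x := by rw [hxs]; positivity
  have ht' : 0 < prevCoord p x := by rw [hxt]; exact mul_pos (by linarith) hD
  have hsum : nextCoord N p x + prevCoord p x = cornerArea N p := by rw [hxs, hxt]; ring
  obtain ⟨hi1, hi2⟩ := h.edge_index_of_coords_pos hi hx' hs' ht'
  have hout : ∀ j, i ≤ j → j ≤ i + 1 → 0 < nextCoord N p (p j) → 0 < prevCoord p (p j) →
      ¬ nextCoord N p (p j) + prevCoord p (p j) ≤ cornerArea N p := by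
    intro j hij hji h1 h2 h3
    have hj1 : j ≠ 1 := by
      rintro rfl
      simp at h2
    have hjN : j ≠ N - 1 := by
      rintro rfl
      simp at h1
    exact hempty j (by omega) (by omega) ⟨h1.le, h2.le, h3⟩
  have key : ∀ j, i ≤ j → j ≤ i + 1 → p j ∈ segment ℝ (p i) (p (i + 1)) →
      cornerArea N p ≤ nextCoord N p (p j) + prevCoord p (p j) := by
    intro j hij hji hj
    by_contra! hlt
    obtain ⟨h1, h2⟩ := h.coords_pos_of_edge hD hi1 hi2 (halfOpenSegment_subset_segment _ _ hx') hj
      hs' ht' hsum.le hlt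
    exact hout j hij hji h1 h2 hlt.le
  have k1 := key i le_rfl (by omega) (left_mem_segment _ _ _)
  have k2 := key (i + 1) (by omega) le_rfl (right_mem_segment _ _ _)
  have o1 := hout i le_rfl (by omega)
  have o2 := hout (i + 1) (by omega) le_rfl
  obtain ⟨q, hq0, hq1, hq⟩ := exists_param hx'
  have es : nextCoord N p x = _ := (congrArg _ hq).trans (nextCoord_add_mul _ _ _)
  have et : prevCoord p x = _ := (congrArg _ hq).trans (prevCoord_add_mul _ _ _)
  have hw : ∀ z ∈ segment ℝ (p i) (p (i + 1)), nextCoord N p z = 0 →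
      prevCoord p z = cornerArea N p → i + 1 = N - 1 := by
    intro z hz h1 h2
    have hz' : z = p (N - 1) := eq_of_coords_eq hD (by simp [h1]) (by simp [h2])
    rw [hz'] at hz
    rcases h.mod_eq_of_mem_segment (left_mem_halfOpenSegment _ _) hz with he | ⟨-, he⟩ <;>
      rw [Nat.mod_eq_of_lt (by omega), Nat.mod_eq_of_lt (by omega)] at he <;> omega
  have hu : ∀ z ∈ segment ℝ (p i) (p (i + 1)), nextCoord N p z = cornerArea N p →
      prevCoord p z = 0 → i = 1 := by
    intro z hz h1 h2
    have hz' : z = p 1 := eq_of_coords_eq hD (by simp [h1]) (by simp [h2])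
    rw [hz'] at hz
    rcases h.mod_eq_of_mem_segment (left_mem_halfOpenSegment _ _) hz with he | ⟨-, he⟩ <;>
      rw [Nat.mod_eq_of_lt (by omega), Nat.mod_eq_of_lt (by omega)] at he <;> omega
  -- No end of the edge lies below the line through `p 1` and `p (N - 1)`, yet `x` is on that line,
  -- so the whole edge is. Its ends are not strictly between `p 1` and `p (N - 1)`, so it contains
  -- both; then `i = 1` and `i + 1 = N - 1`, contradicting `4 ≤ N`.
  have hx0 : nextCoord N p (p i) + prevCoord p (p i) = cornerArea N p := by
    nlinarith
  have hq0' : 0 < q := by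
    refine lt_of_le_of_ne hq0 ?_
    rintro rfl
    simp only [zero_mul, add_zero] at es et
    rw [es] at hs'
    rw [et] at ht'
    exact o1 hs' ht' hx0.le
  have hx1 : nextCoord N p (p (i + 1)) + prevCoord p (p (i + 1)) = cornerArea N p := by
    have : q * (nextCoord N p (p (i + 1)) + prevCoord p (p (i + 1)) - cornerArea N p) = 0 := by
      linear_combination hsum - es - et + (q - 1) * hx0
    rcases mul_eq_zero.1 this with h0 | h0 <;> linarith
  have hends : ∀ σ : ℝ, (nextCoord N p (p i) - σ) * (nextCoord N p (p (i + 1)) - σ) ≤ 0 →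
      nextCoord N p (p i) ≠ nextCoord N p (p (i + 1)) →
      ∃ z ∈ segment ℝ (p i) (p (i + 1)), nextCoord N p z = σ ∧
        prevCoord p z = cornerArea N p - σ := by
    intro σ hσ hne
    set a := nextCoord N p (p i)
    set b := nextCoord N p (p (i + 1))
    have hne' : b - a ≠ 0 := sub_ne_zero.2 hne.symm
    have hq : (σ - a) / (b - a) * (b - a) = σ - a := div_mul_cancel₀ _ hne'
    have hsq : 0 < (b - a) * (b - a) := mul_self_pos.2 hne'
    have e : (σ - a) / (b - a) = (σ - a) * (b - a) / ((b - a) * (b - a)) := by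
      field_simp
    refine ⟨p i + ((σ - a) / (b - a) : ℝ) * (p (i + 1) - p i), ?_, ?_, ?_⟩
    · rw [segment_eq_image']
      refine ⟨(σ - a) / (b - a), ⟨?_, ?_⟩, by simp⟩
      · rw [e]
        apply div_nonneg _ hsq.le
        nlinarith
      · rw [e, div_le_one hsq]
        nlinarith
    · rw [nextCoord_add_mul]
      linarith
    · rw [prevCoord_add_mul]
      linear_combination hx0 - hq + (σ - a) / (b - a) * (hx1 - hx0)
  have hle : ∀ j, nextCoord N p (p j) + prevCoord p (p j) = cornerArea N p →
      (0 < nextCoord N p (p j) → 0 < prevCoord p (p j) →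
        ¬ nextCoord N p (p j) + prevCoord p (p j) ≤ cornerArea N p) →
      nextCoord N p (p j) ≤ 0 ∨ cornerArea N p ≤ nextCoord N p (p j) := by
    intro j hj ho
    by_contra! hc
    exact ho hc.1 (by linarith) hj.le
  have hopp : (nextCoord N p (p i) ≤ 0 ∧ cornerArea N p ≤ nextCoord N p (p (i + 1))) ∨
      (cornerArea N p ≤ nextCoord N p (p i) ∧ nextCoord N p (p (i + 1)) ≤ 0) := by
    rcases hle i hx0 o1 with h1 | h1 <;> rcases hle (i + 1) hx1 o2 with h2 | h2
    · nlinarith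
    · exact Or.inl ⟨h1, h2⟩
    · exact Or.inr ⟨h1, h2⟩
    · nlinarith
  have hne : nextCoord N p (p i) ≠ nextCoord N p (p (i + 1)) := by
    rcases hopp with ⟨h1, h2⟩ | ⟨h1, h2⟩ <;> intro he <;> linarith
  obtain ⟨z, hz, hz1, hz2⟩ := hends 0 (by rcases hopp with ⟨h1, h2⟩ | ⟨h1, h2⟩ <;> nlinarith) hne
  obtain ⟨y, hy, hy1, hy2⟩ := hends (cornerArea N p)
    (by rcases hopp with ⟨h1, h2⟩ | ⟨h1, h2⟩ <;> nlinarith) hne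
  have e1 := hw z hz hz1 (by linarith)
  have e2 := hu y hy hy1 (by linarith)
  omega

end IsSimplePolygon

end Corner

/-! ### Positive turning implies positive area -/

namespace IsSimplePolygon

variable {N : ℕ} {p : ℕ → ℂ}

lemma signedArea_shift (h : IsSimplePolygon N p) (k : ℕ) :
    signedArea N (fun i => p (i + k)) = signedArea N p := by
  rw [signedArea, signedArea, ← sum_range_add_of_periodic (N := N)
    (f := fun i => planeCross (p i) (p (i + 1))) _ k]
  · refine Finset.sum_congr rfl fun i _ => ?_
    rw [show i + 1 + k = i + k + 1 by ring]
  · intro i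
    rw [show i + N + 1 = i + 1 + N by ring, h.periodic, h.periodic]

lemma sum_extAngle_shift (h : IsSimplePolygon N p) (k : ℕ) :
    ∑ i ∈ Finset.range N, extAngle (fun i => p (i + k)) i = ∑ i ∈ Finset.range N, extAngle p i := by
  rw [← sum_range_add_of_periodic h.extAngle_periodic k]
  refine Finset.sum_congr rfl fun i _ => ?_
  rw [extAngle, extAngle, show i + 2 + k = i + k + 2 by ring, show i + 1 + k = i + k + 1 by ring]

/-- The diagonal is traversed once in each direction and cancels. -/
lemma signedArea_eq_add (h : IsSimplePolygon N p) {k : ℕ} (hk : k ≤ N) :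
    signedArea N p = signedArea (k + 1) (_root_.subpolygon p 0 k) +
      signedArea (N - k + 1) (_root_.subpolygon p k (N - k)) := by
  obtain ⟨m, rfl⟩ := Nat.exists_eq_add_of_le hk
  have hp : p (k + m) = p 0 := by simpa using h.periodic 0
  rw [signedArea_subpolygon, signedArea_subpolygon, Nat.add_sub_cancel_left, signedArea,
    Finset.sum_range_add, hp, zero_add]
  simp only [zero_add, planeCross]
  ring

lemma signedArea_eq_ear (h : IsSimplePolygon N p) :
    signedArea N p = signedArea (N - 2 + 1) (_root_.subpolygon p 1 (N - 2)) + cornerArea N p := by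
  have hN := h.three_le
  obtain ⟨m, rfl⟩ : ∃ m, N = m + 2 := ⟨N - 2, by omega⟩
  have hp : p (m + 2) = p 0 := by simpa using h.periodic 0
  rw [signedArea_subpolygon, signedArea, Finset.sum_range_succ, Finset.sum_range_succ', hp,
    cornerArea]
  simp only [Nat.add_sub_cancel, zero_add, show ∀ i, 1 + i = i + 1 from fun i => add_comm 1 i,
    Nat.add_one_sub_one, planeCross, Complex.sub_re, Complex.sub_im]
  ring

/-- A vanishing coordinate would put the vertex on one of the two edges at `p 0`. -/
lemma coords_pos_of_inCorner (h : IsSimplePolygon N p) (hD : 0 < cornerArea N p) {k : ℕ}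
    (hk : 2 ≤ k) (hkN : k + 2 ≤ N) (hc : InCorner N p (p k)) :
    0 < nextCoord N p (p k) ∧ 0 < prevCoord p (p k) := by
  obtain ⟨h1, h2, h3⟩ := hc
  constructor
  · refine lt_of_le_of_ne h1 fun h0 => ?_
    rcases h.mod_eq_of_nextCoord_eq_zero hD (left_mem_halfOpenSegment _ _) h0.symm h2
      (by linarith) with he | he <;> rw [Nat.mod_eq_of_lt (by omega)] at he <;> omega
  · refine lt_of_le_of_ne h2 fun h0 => ?_
    rcases (show nextCoord N p (p k) ≤ cornerArea N p by linarith).lt_or_eq with hlt | heq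
    · have := h.mod_eq_of_mem (i := k) (j := 0) (left_mem_halfOpenSegment _ _)
        (mem_halfOpenSegment_of_coords hD h0.symm h1 hlt)
      rw [Nat.zero_mod, Nat.mod_eq_of_lt (by omega)] at this
      omega
    · have := h.mod_eq_of_eq (eq_of_coords_eq hD (x := p k) (y := p 1) (by simpa using heq)
        (by simpa using h0.symm))
      rw [Nat.mod_eq_of_lt (by omega), Nat.mod_eq_of_lt (by omega)] at this
      omega

/-- A vertex outside the corner triangle yields an extreme vertex other than the three corners. -/
lemma exists_extreme_of_not_inCorner (h : IsSimplePolygon N p) (hD : 0 < cornerArea N p) {j : ℕ}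
    (hj : ¬ InCorner N p (p j)) :
    ∃ k c, 2 ≤ k ∧ k + 2 ≤ N ∧ ∀ i, p i ≠ p k → LexPos (c * (p i - p k)) := by
  -- One of the three inequalities defining the triangle fails at `p j`; its linear form is smaller
  -- there than at all corners, so its minimum is attained at no corner. `cs` and `ct` represent the
  -- two coordinates up to constants.
  have hf : ∃ c : ℂ, (c * p j).re < (c * p 0).re ∧ (c * p j).re < (c * p 1).re ∧
      (c * p j).re < (c * p (N - 1)).re := by
    let cs : ℂ := ⟨(p (N - 1) - p 0).im, (p (N - 1) - p 0).re⟩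
    let ct : ℂ := ⟨-(p 1 - p 0).im, -(p 1 - p 0).re⟩
    have hs : ∀ z, (cs * z).re = nextCoord N p z + (cs * p 0).re := fun z => by
      simp only [cs, nextCoord, planeCross, Complex.mul_re, Complex.sub_re, Complex.sub_im]; ring
    have ht : ∀ z, (ct * z).re = prevCoord p z + (ct * p 0).re := fun z => by
      simp only [ct, prevCoord, planeCross, Complex.mul_re, Complex.sub_re, Complex.sub_im]; ring
    by_cases h1 : 0 ≤ nextCoord N p (p j)
    · by_cases h2 : 0 ≤ prevCoord p (p j)
      · have h3 : cornerArea N p < nextCoord N p (p j) + prevCoord p (p j) := by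
          by_contra! h3
          exact hj ⟨h1, h2, h3⟩
        refine ⟨-(cs + ct), ?_, ?_, ?_⟩ <;>
          simp only [neg_mul, add_mul, Complex.neg_re, Complex.add_re, hs (p j), hs (p 1),
            hs (p (N - 1)), ht (p j), ht (p 1), ht (p (N - 1)), nextCoord_one, prevCoord_one,
            nextCoord_last, prevCoord_last] <;> linarith
      · refine ⟨ct, ?_, ?_, ?_⟩ <;>
          simp only [ht (p j), ht (p 1), ht (p (N - 1)), prevCoord_one, prevCoord_last] <;> linarith
    · refine ⟨cs, ?_, ?_, ?_⟩ <;>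
        simp only [hs (p j), hs (p 1), hs (p (N - 1)), nextCoord_one, nextCoord_last] <;> linarith
  obtain ⟨c, hc0, hc1, hc2⟩ := hf
  have hc : c ≠ 0 := by
    rintro rfl
    simp at hc0
  obtain ⟨k, hkN, hk⟩ := h.exists_extreme hc
  have hle : (c * p k).re ≤ (c * p j).re := by
    by_cases he : p j = p k
    · rw [he]
    · have := hk j he
      rw [LexPos, mul_sub, Complex.sub_re] at this
      rcases this with h1 | h1 <;> linarith
  have k0 : k ≠ 0 := by rintro rfl; linarith
  have k1 : k ≠ 1 := by rintro rfl; linarith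
  have k2 : k ≠ N - 1 := by rintro rfl; linarith
  exact ⟨k, c, by omega, by omega, hk⟩

/-- The induction step for `signedArea_pos`, at a polygon whose vertex `p 0` is extreme. -/
lemma signedArea_pos_of_extreme_zero (h : IsSimplePolygon N p)
    (ih : ∀ M < N, ∀ q, IsSimplePolygon M q → ∑ i ∈ Finset.range M, extAngle q i = 2 * π →
      0 < signedArea M q)
    {c : ℂ} (hc : ∀ i, p i ≠ p 0 → LexPos (c * (p i - p 0)))
    (hT : ∑ i ∈ Finset.range N, extAngle p i = 2 * π) : 0 < signedArea N p := by
  have hN := h.three_le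
  have hpi := Real.pi_pos
  have hD : 0 < cornerArea N p := by
    rcases h.sum_extAngle_of_extreme_zero hc with ⟨h1, -⟩ | ⟨-, h1⟩
    · refine h1.trans_eq ?_
      simp only [cornerArea, planeCross, Complex.sub_re, Complex.sub_im]
      ring
    · linarith
  rcases hN.lt_or_eq with hN4 | rfl
  swap
  · refine hD.trans_eq ?_
    have hp3 : p 3 = p 0 := h.periodic 0
    simp only [signedArea, Finset.sum_range_succ, Finset.sum_range_zero, cornerArea, planeCross,
      zero_add, Nat.reduceAdd, Nat.reduceSub, hp3, Complex.sub_re, Complex.sub_im]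
    ring
  by_cases hempty : ∀ j, 2 ≤ j → j + 2 ≤ N → ¬ InCorner N p (p j)
  · have hear := h.ear_disjoint hD hN4 hempty
    have hsub : IsSimplePolygon (N - 2 + 1) (_root_.subpolygon p 1 (N - 2)) := by
      refine h.subpolygon (by omega) (by omega) ?_
      rwa [show 1 + (N - 2) = N - 1 by omega]
    -- This extreme vertex keeps both its neighbours when `p 0` is cut off, so its positive turn
    -- fixes the turning of the smaller polygon.
    obtain ⟨k, d, hk, hkN, hd⟩ :=
      h.exists_extreme_of_not_inCorner hD (hempty 2 le_rfl (by omega))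
    obtain ⟨m, rfl⟩ : ∃ m, k = m + 2 := ⟨k - 2, by omega⟩
    have e : ∀ i ≤ N - 2, _root_.subpolygon p 1 (N - 2) i = p (1 + i) :=
      fun i hi => subpolygon_apply hi
    have hpos : 0 < planeCross (p (m + 2) - p (m + 1)) (p (m + 3) - p (m + 2)) := by
      rcases h.sum_extAngle_of_extreme (k := m + 1) hd with ⟨h1, -⟩ | ⟨-, h1⟩
      · exact h1
      · linarith
    have hT' : ∑ i ∈ Finset.range (N - 2 + 1),
        extAngle (_root_.subpolygon p 1 (N - 2)) i = 2 * π := by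
      rcases hsub.sum_extAngle_of_extreme (k := m) (c := d) (by
        intro i
        rw [e (m + 1) (by omega), _root_.subpolygon, show 1 + (m + 1) = m + 2 by ring]
        exact hd _) with ⟨-, h1⟩ | ⟨h1, -⟩
      · exact h1
      · rw [e _ (by omega), e _ (by omega), e _ (by omega), show 1 + (m + 1) = m + 2 by ring,
          show 1 + (m + 2) = m + 3 by ring, show 1 + m = m + 1 by ring] at h1
        linarith
    have := ih _ (by omega) _ hsub hT'
    rw [h.signedArea_eq_ear]
    linarith
  · push Not at hempty
    obtain ⟨j, hj, hjN, hjc⟩ := hempty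
    classical
    -- The diagonal goes to the corner vertex with least coordinate sum. In both parts `p 0` stays
    -- extreme, and its turns have the signs of `prevCoord` and `nextCoord` of `p k`, both positive.
    obtain ⟨k, hk, hmin⟩ := Finset.exists_min_image
      ((Finset.range N).filter fun j => 2 ≤ j ∧ j + 2 ≤ N ∧ InCorner N p (p j))
      (fun j => nextCoord N p (p j) + prevCoord p (p j))
      ⟨j, Finset.mem_filter.2 ⟨Finset.mem_range.2 (by omega), hj, hjN, hjc⟩⟩
    obtain ⟨-, hk2, hkN, hkc⟩ := Finset.mem_filter.1 hk
    obtain ⟨hs, ht⟩ := h.coords_pos_of_inCorner hD hk2 hkN hkc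
    have hdiag := h.diagonal_disjoint hD hs ht hkc.2.2 fun j hj hjN hjc =>
      hmin j (Finset.mem_filter.2 ⟨Finset.mem_range.2 (by omega), hj, hjN, hjc⟩)
    have hpN : p N = p 0 := by simpa using h.periodic 0
    have hsub1 : IsSimplePolygon (k + 1) (_root_.subpolygon p 0 k) := by
      refine h.subpolygon hk2 (by omega) ?_
      rwa [zero_add, openSegment_symm]
    have hsub2 : IsSimplePolygon (N - k + 1) (_root_.subpolygon p k (N - k)) := by
      refine h.subpolygon (by omega) (by omega) ?_
      rwa [show k + (N - k) = N by omega, hpN]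
    have hT1 : ∑ i ∈ Finset.range (k + 1), extAngle (_root_.subpolygon p 0 k) i = 2 * π := by
      have e0 : _root_.subpolygon p 0 k (k + 1) = p 0 := subpolygon_add (i := 0) (Nat.zero_le _)
      have e1 : _root_.subpolygon p 0 k (k + 2) = p 1 :=
        subpolygon_add (i := 1) (by omega)
      rcases hsub1.sum_extAngle_of_extreme (k := k) (c := c) (by
        intro i
        rw [e0, _root_.subpolygon]
        exact hc _) with ⟨-, h1⟩ | ⟨h1, -⟩
      · exact h1
      · exfalso
        rw [e0, e1, subpolygon_apply le_rfl, zero_add] at h1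
        simp only [prevCoord, planeCross, Complex.sub_re, Complex.sub_im] at ht h1
        linarith
    have hT2 : ∑ i ∈ Finset.range (N - k + 1),
        extAngle (_root_.subpolygon p k (N - k)) i = 2 * π := by
      have e0 : _root_.subpolygon p k (N - k) (N - k - 1 + 1) = p 0 := by
        rw [subpolygon_apply (by omega), ← hpN]
        congr 1
        omega
      have e1 : _root_.subpolygon p k (N - k) (N - k - 1 + 2) = p k := by
        rw [show N - k - 1 + 2 = N - k + 1 + 0 by omega, subpolygon_add (Nat.zero_le _), add_zero]
      have e2 : _root_.subpolygon p k (N - k) (N - k - 1) = p (N - 1) := by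
        rw [subpolygon_apply (by omega)]
        congr 1
        omega
      rcases hsub2.sum_extAngle_of_extreme (k := N - k - 1) (c := c) (by
        intro i
        rw [e0, _root_.subpolygon]
        exact hc _) with ⟨-, h1⟩ | ⟨h1, -⟩
      · exact h1
      · exfalso
        rw [e0, e1, e2] at h1
        simp only [nextCoord, planeCross, Complex.sub_re, Complex.sub_im] at hs h1
        linarith
    rw [h.signedArea_eq_add (show k ≤ N by omega)]
    exact add_pos (ih _ (by omega) _ hsub1 hT1) (ih _ (by omega) _ hsub2 hT2)

/-- A simple polygon whose total turning is positive has positive area. -/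
theorem signedArea_pos (h : IsSimplePolygon N p)
    (hT : ∑ i ∈ Finset.range N, extAngle p i = 2 * π) : 0 < signedArea N p := by
  induction N using Nat.strong_induction_on generalizing p with
  | _ N ih =>
  obtain ⟨k, -, hk⟩ := h.exists_extreme one_ne_zero
  rw [← h.sum_extAngle_shift k] at hT
  rw [← h.signedArea_shift k]
  refine (h.shift k).signedArea_pos_of_extreme_zero (fun M hM q hq => ih M hM hq) (c := 1) ?_ hT
  intro i
  simp only [zero_add]
  exact hk _

open ComplexConjugate in
lemma conjugate (h : IsSimplePolygon N p) : IsSimplePolygon N (fun i => conj (p i)) where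
  three_le := h.three_le
  periodic i := by rw [h.periodic]
  disjoint i hi j hj hij := by
    have e : ∀ a b : ℂ, halfOpenSegment (conj a) (conj b) = conj '' halfOpenSegment a b := by
      intro a b
      simp only [halfOpenSegment, Set.image_image, map_add, map_mul, map_sub, Complex.conj_ofReal]
    rw [e, e, Set.disjoint_image_iff (starRingEnd ℂ).injective]
    exact h.disjoint i hi j hj hij

/-- Needed because conjugation negates every argument except `π`. Without spikes, consecutive edge
vectors share an open half-plane. -/
lemma extAngle_ne_pi (h : IsSimplePolygon N p) (i : ℕ) : extAngle p i ≠ π := by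
  intro hpi
  obtain ⟨c, h1, h2⟩ := exists_re_pos_of_segment (h.zero_notMem_segment i)
  have := LexPos.arg_div (c := c) (Or.inl h1) (Or.inl h2)
  rw [extAngle, this] at hpi
  have h3 := Complex.abs_arg_lt_pi_div_two_iff.2 (Or.inl h1)
  have h4 := Complex.abs_arg_lt_pi_div_two_iff.2 (Or.inl h2)
  rw [abs_lt] at h3 h4
  linarith [h3.1, h4.2]

/-- Hopf's theorem on the total turning, with the orientation given by the signed area. -/
theorem sum_extAngle_of_signedArea_pos (h : IsSimplePolygon N p) (hA : 0 < signedArea N p) :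
    ∑ i ∈ Finset.range N, extAngle p i = 2 * π := by
  have hN := h.three_le
  obtain ⟨k, -, hk⟩ := (h.shift 1).exists_extreme one_ne_zero
  rcases h.sum_extAngle_of_extreme (k := k) (c := 1) (by
    intro i
    have := hk (i + (N - 1))
    simp only [show i + (N - 1) + 1 = i + N by omega, h.periodic] at this
    exact this) with ⟨-, h1⟩ | ⟨-, h1⟩
  · exact h1
  · exfalso
    -- The mirror image has turning `2π`, hence positive area, so the original area would be
    -- negative.
    have hext : ∀ i, extAngle (fun i => (starRingEnd ℂ) (p i)) i = - extAngle p i := fun i => by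
      have hne := h.extAngle_ne_pi i
      rw [extAngle] at hne
      rw [extAngle, extAngle, ← map_sub, ← map_sub, ← map_div₀, Complex.arg_conj, if_neg hne]
    have := h.conjugate.signedArea_pos (by
      simp only [hext]
      rw [Finset.sum_neg_distrib, h1, neg_neg])
    have e : signedArea N (fun i => (starRingEnd ℂ) (p i)) = - signedArea N p := by
      rw [signedArea, signedArea, ← Finset.sum_neg_distrib]
      refine Finset.sum_congr rfl fun i _ => ?_
      simp only [planeCross, Complex.conj_re, Complex.conj_im]
      ring
    linarith

end IsSimplePolygon

/-! ### From exterior angles to left angles -/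

/-- The two sides agree modulo `2π`, and since `arg` takes values in `(-π, π]` the right side lies
in `[0, 2π)`, the range of `leftAngle`. -/
lemma leftAngle_eq_pi_sub {A B C : ℂ} (hAB : A ≠ B) (hBC : B ≠ C) :
    leftAngle A B C = π - Complex.arg ((C - B) / (B - A)) := by
  have h1 : C - B ≠ 0 := sub_ne_zero.2 hBC.symm
  have h2 : B - A ≠ 0 := sub_ne_zero.2 hAB.symm
  have h3 : (A - B) / (C - B) = -((C - B) / (B - A))⁻¹ := by
    rw [inv_div, ← neg_sub B A, neg_div]
  have h0 : (C - B) / (B - A) ≠ 0 := div_ne_zero h1 h2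
  rw [leftAngle, h3]
  generalize (C - B) / (B - A) = z at h0
  rw [toIcoMod_eq_iff]
  refine ⟨⟨by linarith [Complex.arg_le_pi z], by linarith [Complex.neg_pi_lt_arg z]⟩, ?_⟩
  have : ((Complex.arg (-z⁻¹) : ℝ) : Real.Angle) = ((π - Complex.arg z : ℝ) : Real.Angle) := by
    rw [Complex.arg_neg_coe_angle (inv_ne_zero h0), Complex.arg_inv_coe_angle, Real.Angle.coe_sub,
      neg_add_eq_sub]
  obtain ⟨k, hk⟩ := Real.Angle.angle_eq_iff_two_pi_dvd_sub.1 this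
  exact ⟨k, by rw [zsmul_eq_mul]; linarith⟩

/-- The angle sum of a simple polygon traversed counterclockwise. -/
theorem IsSimplePolygon.sum_leftAngle {N : ℕ} {p : ℕ → ℂ} (h : IsSimplePolygon N p)
    (hA : 0 < signedArea N p) :
    ∑ i ∈ Finset.range N, leftAngle (p i) (p (i + 1)) (p (i + 2)) = ((N : ℝ) - 2) * π := by
  have e : ∀ i, leftAngle (p i) (p (i + 1)) (p (i + 2)) = π - extAngle p i := fun i =>
    leftAngle_eq_pi_sub (h.succ_ne i) (h.succ_ne (i + 1))
  simp only [e]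
  rw [Finset.sum_sub_distrib, h.sum_extAngle_of_signedArea_pos hA]
  simp
  ring

/-! ### Flattening a polygon into the cyclic sequence of its nodes -/

namespace PlanarMapGeometry.Polygon

variable {V E : Type*} [Finite V] [Finite E] {G : PlanarMapGeometry V E} {n : ℕ} [NeZero n]

/-- The number of straight pieces of a polygon. -/
def size (P : G.Polygon n) : ℕ := ∑ j, (P.edge j).len

/-- The number of straight pieces before the `j`-th edge. -/
def start (P : G.Polygon n) (j : Fin n) : ℕ :=
  ∑ i : Fin j, (P.edge (Fin.castLE j.2.le i)).len

lemma size_pos (P : G.Polygon n) : 0 < P.size :=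
  (P.edge 0).len_pos.trans_le
    (Finset.single_le_sum (f := fun j => (P.edge j).len) (fun _ _ => Nat.zero_le _)
      (Finset.mem_univ 0))

/-- The node at a given position. -/
def nodeAt (P : G.Polygon n) (s : Σ j : Fin n, Fin (P.edge j).len) : ℂ := (P.edge s.1).node s.2

/-- The nodes of all the edges in cyclic order. -/
def vert (P : G.Polygon n) (m : ℕ) : ℂ :=
  P.nodeAt (finSigmaFinEquiv.symm
    (⟨m % P.size, Nat.mod_lt _ P.size_pos⟩ : Fin (∑ j, (P.edge j).len)))

lemma vert_mod (P : G.Polygon n) (m : ℕ) : P.vert (m % P.size) = P.vert m := by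
  simp only [vert, Nat.mod_mod]

lemma start_add_eq (P : G.Polygon n) {j : Fin n} {i : ℕ} (hi : i < (P.edge j).len) :
    P.start j + i = (finSigmaFinEquiv ⟨j, ⟨i, hi⟩⟩ : Fin (∑ j, (P.edge j).len)) := by
  rw [finSigmaFinEquiv_apply]
  rfl

lemma start_add_lt (P : G.Polygon n) {j : Fin n} {i : ℕ} (hi : i < (P.edge j).len) :
    P.start j + i < P.size := by
  rw [P.start_add_eq hi]
  exact Fin.is_lt _

lemma vert_start_add_of_lt (P : G.Polygon n) {j : Fin n} {i : ℕ} (hi : i < (P.edge j).len) :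
    P.vert (P.start j + i) = (P.edge j).node i := by
  have : (⟨(P.start j + i) % P.size, Nat.mod_lt _ P.size_pos⟩ : Fin (∑ j, (P.edge j).len)) =
      finSigmaFinEquiv ⟨j, ⟨i, hi⟩⟩ := by
    apply Fin.ext
    rw [← P.start_add_eq hi]
    exact Nat.mod_eq_of_lt (P.start_add_lt hi)
  rw [vert, this, Equiv.symm_apply_apply, nodeAt]

lemma exists_start_add (P : G.Polygon n) {m : ℕ} (hm : m < P.size) :
    ∃ j i, i < (P.edge j).len ∧ m = P.start j + i := by
  obtain ⟨⟨j, i, hi⟩, hs⟩ := finSigmaFinEquiv.surjective (⟨m, hm⟩ : Fin (∑ j, (P.edge j).len))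
  refine ⟨j, i, hi, ?_⟩
  rw [P.start_add_eq hi, hs]

lemma sum_range_size (P : G.Polygon n) (F : ℕ → ℝ) :
    ∑ m ∈ Finset.range P.size, F m =
      ∑ j, ∑ i ∈ Finset.range (P.edge j).len, F (P.start j + i) := by
  rw [Finset.sum_range, size, ← finSigmaFinEquiv.sum_comp, Fintype.sum_sigma]
  refine Finset.sum_congr rfl fun j _ => ?_
  rw [Finset.sum_range]
  refine Finset.sum_congr rfl fun i _ => ?_
  rw [P.start_add_eq i.2]

lemma start_succ_mod (P : G.Polygon n) (j : Fin n) :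
    (P.start j + (P.edge j).len) % P.size = P.start (j + 1) % P.size := by
  obtain ⟨n, rfl⟩ : ∃ k, n = k + 1 := ⟨n - 1, by have := NeZero.pos n; omega⟩
  have e : P.start j + (P.edge j).len =
      ∑ i : Fin (j + 1), (P.edge (Fin.castLE j.2 i)).len := by
    rw [Fin.sum_univ_castSucc]
    rfl
  rw [e]
  rcases eq_or_ne j (Fin.last n) with rfl | hj
  · have e2 : P.start (Fin.last n + 1) = 0 := by
      rw [Fin.last_add_one]
      simp [start]
    rw [e2]
    exact (Nat.mod_self _).trans (Nat.zero_mod _).symm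
  · have hv : ((j + 1 : Fin (n + 1)) : ℕ) = j + 1 :=
      Fin.val_add_one_of_lt (Fin.lt_last_iff_ne_last.2 hj)
    congr 1
    rw [start]
    exact Fintype.sum_equiv (finCongr hv.symm) _ _ fun i => rfl

lemma vert_start_add_len_add (P : G.Polygon n) (j : Fin n) (i : ℕ) :
    P.vert (P.start j + (P.edge j).len + i) = P.vert (P.start (j + 1) + i) := by
  rw [← P.vert_mod, ← P.vert_mod (P.start (j + 1) + i), Nat.add_mod, P.start_succ_mod,
    ← Nat.add_mod]

lemma vert_start_add (P : G.Polygon n) {j : Fin n} {i : ℕ} (hi : i ≤ (P.edge j).len) :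
    P.vert (P.start j + i) = (P.edge j).node i := by
  rcases hi.lt_or_eq with hi | rfl
  · exact P.vert_start_add_of_lt hi
  · rw [P.joined, ← P.vert_start_add_of_lt (P.edge (j + 1)).len_pos]
    exact P.vert_start_add_len_add j 0

lemma signedArea_vert_pos (P : G.Polygon n) : 0 < signedArea P.size P.vert := by
  have h := P.counterclockwise
  rw [signedArea, P.sum_range_size]
  refine (pos_of_mul_pos_right h (by norm_num)).trans_eq ?_
  refine Finset.sum_congr rfl fun j _ => Finset.sum_congr rfl fun i hi => ?_
  have hi := Finset.mem_range.1 hi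
  rw [P.vert_start_add hi.le, add_assoc, P.vert_start_add hi, planeCross]

lemma isSimplePolygon_vert (P : G.Polygon n) : IsSimplePolygon P.size P.vert where
  -- A closed sequence of fewer than three vertices has signed area zero; so even a `1`-polygon or
  -- `2`-polygon has at least three straight pieces.
  three_le := by
    have h := P.signedArea_vert_pos
    have hmod := P.vert_mod
    by_contra! hlt
    generalize P.size = N at h hmod hlt
    interval_cases N
    · simp [signedArea] at h
    · have := hmod 1
      simp only [signedArea, planeCross, Finset.sum_range_one, zero_add, ← this, Nat.mod_self] at h
      linarith
    · have := hmod 2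
      simp only [signedArea, planeCross, Finset.sum_range_succ, Finset.sum_range_zero, zero_add,
        Nat.reduceAdd, ← this, Nat.mod_self] at h
      linarith
  periodic i := by rw [← P.vert_mod, Nat.add_mod_right, P.vert_mod]
  disjoint m hm m' hm' hne := by
    obtain ⟨j, i, hi, rfl⟩ := P.exists_start_add hm
    obtain ⟨j', i', hi', rfl⟩ := P.exists_start_add hm'
    rw [add_assoc, add_assoc, P.vert_start_add hi.le, P.vert_start_add hi, P.vert_start_add hi'.le,
      P.vert_start_add hi']
    refine P.simple j j' i hi i' hi' ?_
    by_contra! hc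
    obtain ⟨rfl, rfl⟩ := hc
    exact hne rfl

/-- The sum of the angles at all nodes of a polygon. -/
lemma sum_internalAngle_add_bends (P : G.Polygon n) :
    ∑ j, (P.internalAngle j + ∑ i ∈ Finset.range ((P.edge j).len - 1),
      G.angle ((P.edge j).node (i + 1))) = ((P.size : ℝ) - 2) * π := by
  rw [← P.isSimplePolygon_vert.sum_leftAngle P.signedArea_vert_pos, P.sum_range_size]
  refine Finset.sum_congr rfl fun j _ => ?_
  obtain ⟨m, hm⟩ : ∃ m, (P.edge j).len = m + 1 :=
    ⟨(P.edge j).len - 1, by have := (P.edge j).len_pos; omega⟩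
  -- The last piece of an edge ends at a vertex of the polygon and gives the internal angle; all
  -- earlier pieces end at bends.
  rw [hm, Finset.sum_range_succ, Nat.add_sub_cancel, add_comm]
  congr 1
  · refine Finset.sum_congr rfl fun i hi => ?_
    have hi := Finset.mem_range.1 hi
    rw [add_assoc, add_assoc, P.vert_start_add (by omega), P.vert_start_add (by omega),
      P.vert_start_add (by omega), (P.edge j).bend i (by omega)]
  · have h2 := P.vert_start_add_len_add j 1
    rw [P.vert_start_add (P.edge (j + 1)).len_pos, hm] at h2
    rw [internalAngle, hm, ← h2, P.vert_start_add (i := m) (by omega),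
      add_assoc _ m 1, P.vert_start_add (i := m + 1) (by omega)]
    simp only [Nat.add_sub_cancel, add_assoc, Nat.reduceAdd]

/-! ### Bends, non-euclidean points and the angle formula -/

/-- The positions of the intermediate nodes of the edges. -/
def bends (P : G.Polygon n) : Finset (Σ _ : Fin n, ℕ) :=
  Finset.univ.sigma fun j => Finset.range ((P.edge j).len - 1)

/-- The intermediate node at a given position. -/
def bendPt (P : G.Polygon n) (s : Σ _ : Fin n, ℕ) : ℂ := (P.edge s.1).node (s.2 + 1)

lemma mem_bends {P : G.Polygon n} {s : Σ _ : Fin n, ℕ} :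
    s ∈ P.bends ↔ s.2 + 1 < (P.edge s.1).len := by
  simp only [bends, Finset.mem_sigma, Finset.mem_univ, true_and, Finset.mem_range]
  omega

lemma bendPt_injOn (P : G.Polygon n) : Set.InjOn P.bendPt P.bends := by
  rintro ⟨j, i⟩ hs ⟨j', i'⟩ hs' he
  rw [Finset.mem_coe, mem_bends] at hs hs'
  by_contra hne
  have := P.simple j j' (i + 1) hs (i' + 1) hs' (by
    by_contra! hc
    obtain ⟨rfl, hc⟩ := hc
    obtain rfl : i = i' := by omega
    exact hne rfl)
  refine Set.disjoint_left.1 this (left_mem_halfOpenSegment _ _) ?_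
  change P.bendPt ⟨j, i⟩ ∈ _
  rw [he]
  exact left_mem_halfOpenSegment _ _

open Classical in
-- The open straight pieces consist of euclidean points, so only intermediate nodes can be
-- non-euclidean; finiteness follows.
lemma nonEuclideanPts_eq (P : G.Polygon n) :
    P.nonEuclideanPts =
      ((P.bends.filter fun s => G.angle (P.bendPt s) ≠ π).image P.bendPt : Finset ℂ) := by
  ext x
  simp only [nonEuclideanPts, MSegment.inner, Set.mem_ofPred_eq, Finset.coe_image, Set.mem_image,
    Finset.mem_coe, Finset.mem_filter, mem_bends, IsEuclideanPt]
  constructor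
  · rintro ⟨⟨j, i, hi, hx | ⟨hi0, rfl⟩⟩, hne⟩
    · exact absurd ((P.edge j).straight i hi x hx) hne
    · obtain ⟨i, rfl⟩ := Nat.exists_eq_add_of_lt hi0
      rw [zero_add] at *
      exact ⟨⟨j, i⟩, ⟨hi, hne⟩, rfl⟩
  · rintro ⟨⟨j, i⟩, ⟨hi, hne⟩, rfl⟩
    exact ⟨⟨j, i + 1, hi, Or.inr ⟨Nat.succ_pos _, rfl⟩⟩, hne⟩

lemma nonEuclideanPts_finite (P : G.Polygon n) : P.nonEuclideanPts.Finite := by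
  classical
  rw [P.nonEuclideanPts_eq]
  exact Finset.finite_toSet _

/-- With `f - π` as summand euclidean bends drop out, and simplicity ensures that no point is
counted twice. -/
lemma sum_angle_sub_pi (P : G.Polygon n) {l : ℕ} {x : Fin l → ℂ} (hx : Function.Injective x)
    (hr : Set.range x = P.nonEuclideanPts) :
    ∑ i, (G.angle (x i) - π) = ∑ s ∈ P.bends, (G.angle (P.bendPt s) - π) := by
  classical
  rw [P.nonEuclideanPts_eq] at hr
  have hr' : Finset.univ.image x =
      (P.bends.filter fun s => G.angle (P.bendPt s) ≠ π).image P.bendPt := by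
    apply Finset.coe_injective
    rw [← hr, Finset.coe_image, Finset.coe_univ, Set.image_univ]
  rw [← Finset.sum_image (f := fun z => G.angle z - π) (g := x) hx.injOn, hr',
    Finset.sum_image (P.bendPt_injOn.mono (Finset.coe_subset.2 (Finset.filter_subset _ _))), Finset.sum_filter]
  refine Finset.sum_congr rfl fun s _ => ?_
  split_ifs with h
  · rfl
  · rw [not_not.1 h, sub_self]

theorem sum_internalAngle (P : G.Polygon n) {l : ℕ} {x : Fin l → ℂ} (hx : Function.Injective x)
    (hr : Set.range x = P.nonEuclideanPts) :
    ∑ j, P.internalAngle j = ((n : ℝ) + (l : ℝ) - 2) * π - ∑ i, G.angle (x i) := by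
  have h1 := P.sum_internalAngle_add_bends
  have h2 := P.sum_angle_sub_pi hx hr
  have h3 : ∑ s ∈ P.bends, (G.angle (P.bendPt s) - π) =
      ∑ j, ∑ i ∈ Finset.range ((P.edge j).len - 1), G.angle ((P.edge j).node (i + 1)) -
        ((P.size : ℝ) - n) * π := by
    rw [bends, Finset.sum_sigma]
    simp only [bendPt, Finset.sum_sub_distrib, Finset.sum_const, Finset.card_range, nsmul_eq_mul]
    rw [← Finset.sum_mul]
    congr 2
    have : ∀ j, (((P.edge j).len - 1 : ℕ) : ℝ) = (P.edge j).len - 1 := fun j => by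
      rw [Nat.cast_sub (P.edge j).len_pos, Nat.cast_one]
    simp only [this, Finset.sum_sub_distrib, size, Nat.cast_sum]
    simp
  rw [Finset.sum_add_distrib] at h1
  rw [h3, Finset.sum_sub_distrib] at h2
  simp only [Finset.sum_const, Finset.card_univ, Fintype.card_fin, nsmul_eq_mul] at h2
  linarith

/-- The non-euclidean points listed without repetition. -/
lemma exists_enumeration (P : G.Polygon n) :
    ∃ (l : ℕ) (x : Fin l → ℂ), Function.Injective x ∧ Set.range x = P.nonEuclideanPts := by
  let e := P.nonEuclideanPts_finite.toFinset.equivFin.symm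
  refine ⟨_, fun i => (e i : ℂ), Subtype.val_injective.comp e.injective, ?_⟩
  ext z
  simp only [Set.mem_range]
  constructor
  · rintro ⟨i, rfl⟩
    exact P.nonEuclideanPts_finite.mem_toFinset.1 (e i).2
  · intro hz
    exact ⟨e.symm ⟨z, P.nonEuclideanPts_finite.mem_toFinset.2 hz⟩, by simp⟩

/-- The angular excess of a triangle is the total defect of the points on its edges. -/
lemma sum_internalAngle_triangle (T : G.Polygon 3) {l : ℕ} {x : Fin l → ℂ}
    (hx : Function.Injective x) (hr : Set.range x = T.nonEuclideanPts) :
    ∑ j, T.internalAngle j = π + ∑ i, (π - G.angle (x i)) := by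
  rw [T.sum_internalAngle hx hr, Finset.sum_sub_distrib]
  simp
  ring

end PlanarMapGeometry.Polygon

theorem theorem4p3p4 {V E : Type*} [Finite V] [Finite E] (G : PlanarMapGeometry V E) :
    (∀ (n : ℕ) [NeZero n] (P : G.Polygon n),
      P.nonEuclideanPts.Finite ∧
      ∀ (l : ℕ) (x : Fin l → ℂ), Function.Injective x → Set.range x = P.nonEuclideanPts →
        ∑ j, P.internalAngle j = ((n : ℝ) + (l : ℝ) - 2) * π - ∑ i, G.angle (x i)) ∧
    (∀ T : G.Polygon 3,
      (T.IsEuclidean → ∑ j, T.internalAngle j = π) ∧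
      (T.IsElliptic → π < ∑ j, T.internalAngle j) ∧
      (T.IsHyperbolic → ∑ j, T.internalAngle j < π)) := by
  refine ⟨fun n _ P => ⟨P.nonEuclideanPts_finite, fun l x hx hr => P.sum_internalAngle hx hr⟩,
    fun T => ?_⟩
  obtain ⟨l, x, hx, hr⟩ := T.exists_enumeration
  have hsum := T.sum_internalAngle_triangle hx hr
  have hmem : ∀ i, x i ∈ T.nonEuclideanPts := fun i => hr ▸ Set.mem_range_self i
  have hne : T.nonEuclideanPts.Nonempty → (Finset.univ : Finset (Fin l)).Nonempty := by
    rintro ⟨z, hz⟩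
    rw [← hr] at hz
    obtain ⟨i, -⟩ := hz
    exact ⟨i, Finset.mem_univ i⟩
  rw [hsum]
  refine ⟨fun h => ?_, fun h => ?_, fun h => ?_⟩
  · rw [Finset.sum_eq_zero, add_zero]
    intro i _
    exact absurd (hmem i) (by rw [h]; exact Set.notMem_empty _)
  · have := Finset.sum_pos (fun i _ => sub_pos.2 (h.2 _ (hmem i))) (hne h.1)
    linarith
  · have := Finset.sum_neg (fun i _ => sub_neg.2 (h.2 _ (hmem i))) (hne h.1)
    linarith
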